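/- For a finite group $G$ let $R(G)$ denote the Grothendieck group of finite-dimensional $\mathbb{Q}G$-modules, and let $S_n$ be the symmetric group on $[n]=\{1,\dots,n\}$. Let $R=\prod_{n\ge 0}R(S_n)$ be the completion of the graded ring $\bigoplus_{n\ge 0}R(S_n)$, whose product is the induction product $[V]\cdot[W]=[\mathrm{Ind}_{S_i\times S_j}^{S_{i+j}}(V\boxtimes W)]$ for $V$ a module over $\mathbb{Q}S_i$ and $W$ a module over $\mathbb{Q}S_j$, and whose identity element is the class $1=1_{S_0}$ of the trivial representation of $S_0$; elements of $R$ are written as formal sums of their components. Write $1_{S_n}\in R(S_n)$ for the class of the trivial representation. For $n\ge 2$ even, let $B_n^{\mathrm{ev}}$ be the poset of even-size subsets of $[n]$ ordered by inclusion, and let $H_{n/2}(\emptyset,[n])=\widetilde H_{n/2-2}\big((\emptyset,[n]);\mathbb{Q}\big)$ be the top reduced homology group of the order complex of the open interval $(\emptyset,[n])$ in $B_n^{\mathrm{ev}}$ (for $n=2$ the interval is empty and this is $\widetilde H_{-1}(\emptyset;\mathbb{Q})=\mathbb{Q}$), with the action of $S_n$ induced by permuting $[n]$. **Proposition.** The element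 $1+\sum_{n\ge 2\text{ even}}1_{S_n}$ is invertible in $R$, and \[ 1+\sum_{\substack{n\ge 2\\ n\text{ even}}}(-1)^{n/2}\,H_{n/2}(\emptyset,[n]) =\Big(1+\sum_{\substack{n\ge 2\\ n\text{ even}}}1_{S_n}\Big)^{-1} \] in $R$. -/

import Mathlib

namespace SymRep

set_option linter.unusedSectionVars false

open Representation

section RepGroup

variable {G H K : Type} [Group G] [Group H] [Group K]

/-- The relations `[B] - [A] - [C]`, one for every short exact sequence `0 → A → B → C → 0` of
finite-dimensional `ℚ`-linear representations of `G`. -/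
def shortExactRel (G : Type) [Group G] : Set (FreeAbelianGroup (FDRep ℚ G)) :=
  {x | ∃ (A B C : FDRep ℚ G) (f : IntertwiningMap A.ρ B.ρ) (g : IntertwiningMap B.ρ C.ρ),
    Function.Injective f ∧ Function.Surjective g ∧ Function.Exact f g ∧
    x = FreeAbelianGroup.of B - FreeAbelianGroup.of A - FreeAbelianGroup.of C}

/-- The Grothendieck group `R(G)` of finite-dimensional `ℚG`-modules. -/
def RepGroup (G : Type) [Group G] : Type 1 :=
  FreeAbelianGroup (FDRep ℚ G) ⧸ AddSubgroup.closure (shortExactRel G)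

noncomputable instance : AddCommGroup (RepGroup G) :=
  inferInstanceAs (AddCommGroup (FreeAbelianGroup (FDRep ℚ G) ⧸
    AddSubgroup.closure (shortExactRel G)))

/-- The class `[V]` in `R(G)` of a finite-dimensional representation `V`. -/
noncomputable def RepGroup.of {V : Type} [AddCommGroup V] [Module ℚ V] [Module.Finite ℚ V]
    (ρ : Representation ℚ G V) : RepGroup G :=
  QuotientAddGroup.mk (FreeAbelianGroup.of (FDRep.of ρ))

section
variable {U V W : Type} [AddCommGroup U] [Module ℚ U] [Module.Finite ℚ U]
  [AddCommGroup V] [Module ℚ V] [Module.Finite ℚ V]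
  [AddCommGroup W] [Module ℚ W] [Module.Finite ℚ W]
  {ρ : Representation ℚ G U} {σ : Representation ℚ G V} {τ : Representation ℚ G W}

theorem RepGroup.of_exact (f : IntertwiningMap ρ σ) (g : IntertwiningMap σ τ)
    (hf : Function.Injective f) (hg : Function.Surjective g) (h : Function.Exact f g) :
    RepGroup.of σ = RepGroup.of ρ + RepGroup.of τ := by
  have : (QuotientAddGroup.mk (FreeAbelianGroup.of (FDRep.of σ) - FreeAbelianGroup.of (FDRep.of ρ)
      - FreeAbelianGroup.of (FDRep.of τ)) : RepGroup G) = 0 :=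
    (QuotientAddGroup.eq_zero_iff _).2 (AddSubgroup.subset_closure
      ⟨FDRep.of ρ, FDRep.of σ, FDRep.of τ, f, g, hf, hg, h, rfl⟩)
  have h2 : RepGroup.of σ - RepGroup.of ρ - RepGroup.of τ = 0 := this
  rw [sub_sub, sub_eq_zero] at h2
  exact h2

theorem RepGroup.of_split (f : IntertwiningMap ρ σ) (g : IntertwiningMap σ τ)
    (r : IntertwiningMap σ ρ) (s : IntertwiningMap τ σ) (hrf : r.comp f = .id ρ)
    (hgs : g.comp s = .id τ) (hgf : g.comp f = 0)
    (h : f.comp r + s.comp g = .id σ) :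
    RepGroup.of σ = RepGroup.of ρ + RepGroup.of τ := by
  have e1 (x) : r (f x) = x := congr($hrf x)
  have e2 (x) : g (s x) = x := congr($hgs x)
  have e3 (x) : g (f x) = 0 := congr($hgf x)
  have e4 (x) : f (r x) + s (g x) = x := congr($h x)
  refine RepGroup.of_exact f g (Function.LeftInverse.injective e1)
    (Function.RightInverse.surjective e2) fun y => ⟨fun hy => ⟨r y, ?_⟩, ?_⟩
  · have := e4 y
    rwa [hy, map_zero, add_zero] at this
  · rintro ⟨x, rfl⟩
    exact e3 x

theorem RepGroup.of_congr (f : IntertwiningMap ρ σ) (g : IntertwiningMap σ ρ)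
    (h1 : g.comp f = .id ρ) (h2 : f.comp g = .id σ) : RepGroup.of ρ = RepGroup.of σ := by
  have e1 (x) : g (f x) = x := congr($h1 x)
  have e2 (x) : f (g x) = x := congr($h2 x)
  have h0 := RepGroup.of_exact (.id (Representation.trivial ℚ G PUnit.{1}))
    (.id (Representation.trivial ℚ G PUnit.{1})) (fun _ _ _ => rfl) (fun x => ⟨x, rfl⟩)
    (fun x => ⟨fun _ => ⟨x, rfl⟩, fun _ => rfl⟩)
  have := RepGroup.of_exact (τ := Representation.trivial ℚ G PUnit.{1}) f 0
    (Function.LeftInverse.injective e1) (fun x => ⟨0, rfl⟩)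
    (fun x => ⟨fun _ => ⟨g x, e2 x⟩, fun _ => rfl⟩)
  rw [this, left_eq_add.1 h0, add_zero]

theorem exists_splitting [Finite G] (f : IntertwiningMap ρ σ) (g : IntertwiningMap σ τ)
    (hf : Function.Injective f) (hg : Function.Surjective g) (h : Function.Exact f g) :
    ∃ (r : IntertwiningMap σ ρ) (s : IntertwiningMap τ σ), r.comp f = .id ρ ∧
      g.comp s = .id τ ∧ g.comp f = 0 ∧ f.comp r + s.comp g = .id σ := by
  classical
  have := Fintype.ofFinite G
  obtain ⟨s₀, hs₀⟩ := g.toLinearMap.exists_rightInverse_of_surjective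
    (LinearMap.range_eq_top.2 hg)
  have hs₀' (x) : g (s₀ x) = x := congr($hs₀ x)
  have hcard : (Fintype.card G : ℚ) ≠ 0 := by
    exact_mod_cast Fintype.card_ne_zero
  let s : IntertwiningMap τ σ := LinearMap.intertwiningMap_of_isIntertwiningMap τ σ
    ((Fintype.card G : ℚ)⁻¹ • ∑ a : G, σ a⁻¹ ∘ₗ s₀ ∘ₗ τ a) (fun a v => by
      simp only [LinearMap.smul_apply, LinearMap.sum_apply, LinearMap.comp_apply, map_smul, map_sum]
      congr 1
      refine Fintype.sum_equiv (Equiv.mulRight a) _ _ fun b => ?_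
      simp only [Equiv.coe_mulRight, mul_inv_rev, map_mul, Module.End.mul_apply]
      rw [← Module.End.mul_apply (σ a), ← map_mul, mul_inv_cancel, map_one, Module.End.one_apply])
  have hs (x) : g (s x) = x := by
    change g ((((Fintype.card G : ℚ)⁻¹ • ∑ a : G, σ a⁻¹ ∘ₗ s₀ ∘ₗ τ a) : W →ₗ[ℚ] V) x) = x
    simp only [LinearMap.smul_apply, LinearMap.sum_apply, LinearMap.comp_apply, map_smul, map_sum,
      g.isIntertwining, hs₀']
    simp only [← Module.End.mul_apply, ← map_mul, inv_mul_cancel, map_one, Module.End.one_apply]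
    rw [Finset.sum_const, Finset.card_univ, ← Nat.cast_smul_eq_nsmul ℚ, smul_smul,
      inv_mul_cancel₀ hcard, one_smul]
  have hex (y : V) : ∃ x, f x = y - s (g y) := (h _).1 (by rw [map_sub, hs, sub_self])
  choose r₀ hr₀ using hex
  let r₁ : V →ₗ[ℚ] U :=
    { toFun := r₀
      map_add' := fun x y => hf (by rw [map_add, hr₀, hr₀, hr₀, map_add, map_add]; abel)
      map_smul' := fun c x => hf (by
        rw [RingHom.id_apply, map_smul, hr₀, hr₀, map_smul, map_smul, smul_sub]) }
  let r : IntertwiningMap σ ρ := LinearMap.intertwiningMap_of_isIntertwiningMap σ ρ r₁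
    (fun a v => hf (by
      change f (r₀ _) = f (ρ a (r₀ v))
      rw [f.isIntertwining, hr₀, hr₀, map_sub, g.isIntertwining, s.isIntertwining]))
  have hr (y) : f (r y) = y - s (g y) := hr₀ y
  have hgf (x) : g (f x) = 0 := (h _).2 ⟨x, rfl⟩
  refine ⟨r, s, ?_, ?_, ?_, ?_⟩
  · ext x
    exact hf ((hr (f x)).trans (by rw [hgf, map_zero, sub_zero]; rfl))
  · ext x
    exact hs x
  · ext x
    exact hgf x
  · ext x
    change f (r x) + s (g x) = x
    rw [hr, sub_add_cancel]

end

/-- A function on representations which is additive on split short exact sequences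
induces a homomorphism on the Grothendieck group. -/
noncomputable def RepGroup.lift [Finite G] {M : Type*} [AddCommGroup M] (F : FDRep ℚ G → M)
    (hF : ∀ (A B C : FDRep ℚ G) (f : IntertwiningMap A.ρ B.ρ) (g : IntertwiningMap B.ρ C.ρ)
      (r : IntertwiningMap B.ρ A.ρ) (s : IntertwiningMap C.ρ B.ρ), r.comp f = .id _ →
      g.comp s = .id _ → g.comp f = 0 → f.comp r + s.comp g = .id _ → F B = F A + F C) :
    RepGroup G →+ M :=
  QuotientAddGroup.lift _ (FreeAbelianGroup.lift F) (by
    rw [AddSubgroup.closure_le]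
    rintro x ⟨A, B, C, f, g, hf, hg, h, rfl⟩
    obtain ⟨r, s, h1, h2, h3, h4⟩ := exists_splitting f g hf hg h
    change FreeAbelianGroup.lift F _ = 0
    rw [map_sub, map_sub, FreeAbelianGroup.lift_apply_of, FreeAbelianGroup.lift_apply_of,
      FreeAbelianGroup.lift_apply_of, hF A B C f g r s h1 h2 h3 h4]
    abel)

theorem RepGroup.lift_of [Finite G] {M : Type*} [AddCommGroup M] (F : FDRep ℚ G → M) (hF)
    {V : Type} [AddCommGroup V] [Module ℚ V] [Module.Finite ℚ V] (ρ : Representation ℚ G V) :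
    RepGroup.lift F hF (RepGroup.of ρ) = F (FDRep.of ρ) :=
  FreeAbelianGroup.lift_apply_of _ _

theorem RepGroup.hom_ext {M : Type*} [AddCommGroup M] {f g : RepGroup G →+ M}
    (h : ∀ {V : Type} [AddCommGroup V] [Module ℚ V] [Module.Finite ℚ V]
      (ρ : Representation ℚ G V), f (RepGroup.of ρ) = g (RepGroup.of ρ)) : f = g := by
  refine QuotientAddGroup.addMonoidHom_ext _ (FreeAbelianGroup.lift_ext _ _ fun V => ?_)
  exact h V.ρ


section Ind

variable {V W : Type} [AddCommGroup V] [Module ℚ V] [AddCommGroup W] [Module ℚ W]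

/-- The map out of an induced representation given by Frobenius reciprocity. -/
noncomputable def indLift {φ : G →* H} {ρ : Representation ℚ G V} {τ : Representation ℚ H W}
    (f : V →ₗ[ℚ] W) (hf : ∀ g v, f (ρ g v) = τ (φ g) (f v)) : IntertwiningMap (ρ.ind φ) τ :=
  ((Rep.indResHomEquiv φ (Rep.of ρ) (Rep.of τ)).symm (Rep.ofHom
    (f.intertwiningMap_of_isIntertwiningMap ρ (τ.comp φ) hf))).hom

/-- The canonical map `V → Ind V`. -/
noncomputable def indMk (φ : G →* H) (ρ : Representation ℚ G V) : V →ₗ[ℚ] IndV φ ρ :=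
  IndV.mk φ ρ 1

theorem rho_rho (ρ : Representation ℚ G V) (g h : G) (v : V) : ρ g (ρ h v) = ρ (g * h) v := by
  rw [map_mul]; rfl

theorem rho_one (ρ : Representation ℚ G V) (v : V) : ρ 1 v = v := by
  rw [map_one]; rfl

theorem indLift_mk {φ : G →* H} {ρ : Representation ℚ G V} {τ : Representation ℚ H W}
    (f : V →ₗ[ℚ] W) (hf : ∀ g v, f (ρ g v) = τ (φ g) (f v)) (v : V) :
    indLift (φ := φ) (ρ := ρ) (τ := τ) f hf (indMk φ ρ v) = f v := by
  simp [indLift, indMk, IndV.mk]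

theorem ind_ext {φ : G →* H} {ρ : Representation ℚ G V} {τ : Representation ℚ H W}
    {f g : IntertwiningMap (ρ.ind φ) τ}
    (h : ∀ v, f (indMk φ ρ v) = g (indMk φ ρ v)) : f = g := by
  ext : 1
  refine IndV.hom_ext φ ρ fun a => LinearMap.ext fun v => ?_
  have : IndV.mk φ ρ a v = ρ.ind φ a⁻¹ (indMk φ ρ v) := by
    rw [indMk, ind_mk, inv_inv, one_mul]
  change f (IndV.mk φ ρ a v) = g (IndV.mk φ ρ a v)
  rw [this, f.isIntertwining, g.isIntertwining, h]

theorem ind_mk_equivariant (φ : G →* H) (ρ : Representation ℚ G V) (g : G) (v : V) :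
    indMk φ ρ (ρ g v) = ρ.ind φ (φ g) (indMk φ ρ v) := by
  rw [indMk, ind_mk, one_mul]
  simpa [IndV.mk] using
    (Coinvariants.mk_self_apply (Representation.tprod (MonoidHom.comp (leftRegular ℚ H) φ) ρ) g
      (TensorProduct.tmul ℚ (MonoidAlgebra.single (φ g)⁻¹ (1 : ℚ)) v))


variable [Module.Finite ℚ V] [Module.Finite ℚ W]

instance [Finite H] (φ : G →* H) (ρ : Representation ℚ G V) : Module.Finite ℚ (IndV φ ρ) := by
  have : Module.Finite ℚ (MonoidAlgebra ℚ H) :=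
    Module.Finite.equiv (MonoidAlgebra.coeffLinearEquiv ℚ).symm
  infer_instance

/-- Functoriality of induction. -/
noncomputable def indMap (φ : G →* H) {ρ : Representation ℚ G V} {τ : Representation ℚ G W}
    (f : IntertwiningMap ρ τ) : IntertwiningMap (ρ.ind φ) (τ.ind φ) :=
  indLift (indMk φ τ ∘ₗ f.toLinearMap) (fun g v => by
    rw [LinearMap.comp_apply, LinearMap.comp_apply, ← ind_mk_equivariant,
      IntertwiningMap.toLinearMap_apply, f.isIntertwining]; rfl)

theorem indMap_mk (φ : G →* H) {ρ : Representation ℚ G V} {τ : Representation ℚ G W}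
    (f : IntertwiningMap ρ τ) (v : V) :
    indMap φ f (indMk φ ρ v) = indMk φ τ (f v) := indLift_mk _ _ _

/-- Induction along a homomorphism `φ : G → H` of finite groups, `R(G) → R(H)`,
`[V] ↦ [Ind V]`. -/
noncomputable def RepGroup.ind [Finite G] [Finite H] (φ : G →* H) : RepGroup G →+ RepGroup H :=
  RepGroup.lift (fun V => RepGroup.of (Representation.ind φ V.ρ)) fun A B C f g r s h1 h2 h3 h4 => by
    refine RepGroup.of_split (indMap φ f) (indMap φ g) (indMap φ r) (indMap φ s)
      (ind_ext fun v => ?_) (ind_ext fun v => ?_) (ind_ext fun v => ?_) (ind_ext fun v => ?_)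
    · have e (x) : r (f x) = x := congr($h1 x)
      change indMap φ r (indMap φ f _) = indMk φ A.ρ v
      rw [indMap_mk, indMap_mk, e]
    · have e (x) : g (s x) = x := congr($h2 x)
      change indMap φ g (indMap φ s _) = indMk φ C.ρ v
      rw [indMap_mk, indMap_mk, e]
    · have e (x) : g (f x) = 0 := congr($h3 x)
      change indMap φ g (indMap φ f _) = 0
      rw [indMap_mk, indMap_mk, e, map_zero]
    · have e (x) : f (r x) + s (g x) = x := congr($h4 x)
      change indMap φ f (indMap φ r _) + indMap φ s (indMap φ g _) = indMk φ B.ρ v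
      rw [indMap_mk, indMap_mk, indMap_mk, indMap_mk, ← map_add, e]

theorem RepGroup.ind_of [Finite G] [Finite H] (φ : G →* H) (ρ : Representation ℚ G V) :
    RepGroup.ind φ (RepGroup.of ρ) = RepGroup.of (ρ.ind φ) :=
  RepGroup.lift_of (fun V => RepGroup.of (Representation.ind φ V.ρ)) _ ρ

theorem RepGroup.ind_ind [Finite G] [Finite H] [Finite K] (ψ : H →* K) (φ : G →* H)
    (x : RepGroup G) : RepGroup.ind ψ (RepGroup.ind φ x) = RepGroup.ind (ψ.comp φ) x := by
  suffices (RepGroup.ind ψ).comp (RepGroup.ind φ) = RepGroup.ind (ψ.comp φ) from congr($this x)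
  refine RepGroup.hom_ext fun {V} _ _ _ ρ => ?_
  rw [AddMonoidHom.comp_apply, RepGroup.ind_of, RepGroup.ind_of, RepGroup.ind_of]
  let F₁ : IntertwiningMap (ρ.ind φ) (MonoidHom.comp (ρ.ind (ψ.comp φ)) ψ) :=
    indLift (indMk (ψ.comp φ) ρ) (fun g v => ind_mk_equivariant _ _ _ _)
  have hF₁ (v) : F₁ (indMk _ _ v) = indMk _ _ v := indLift_mk _ _ _
  let F : IntertwiningMap ((ρ.ind φ).ind ψ) (ρ.ind (ψ.comp φ)) :=
    indLift F₁.toLinearMap (fun g v => F₁.isIntertwining _ _ g v)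
  have hF (v) : F (indMk _ _ v) = F₁ v := indLift_mk _ _ _
  let E : IntertwiningMap (ρ.ind (ψ.comp φ)) ((ρ.ind φ).ind ψ) :=
    indLift (indMk ψ _ ∘ₗ indMk φ ρ) (fun g v => by
      rw [LinearMap.comp_apply, LinearMap.comp_apply, ind_mk_equivariant, ind_mk_equivariant]; rfl)
  have hE (v) : E (indMk _ _ v) = indMk ψ _ (indMk φ ρ v) := indLift_mk _ _ _
  refine RepGroup.of_congr F E ?_ ?_
  · have key : (IntertwiningMap.comp (ρ := ρ.ind φ) (τ := MonoidHom.comp ((ρ.ind φ).ind ψ) ψ)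
        ⟨E.toLinearMap, fun g => E.isIntertwining' (ψ g)⟩ F₁) =
        ⟨indMk ψ _, fun g => LinearMap.ext fun v => ind_mk_equivariant _ _ _ _⟩ := by
      refine ind_ext fun v => ?_
      change E (F₁ _) = indMk ψ _ _
      rw [hF₁, hE]
    refine ind_ext fun v => ?_
    change E (F _) = indMk ψ _ v
    rw [hF]
    exact congr($key v)
  · refine ind_ext fun v => ?_
    change F (E _) = indMk _ _ v
    rw [hE, hF, hF₁]

theorem RepGroup.ind_conj [Finite G] [Finite H] (φ φ' : G →* H) (h : H)
    (hh : ∀ g, φ' g * h = h * φ g) : RepGroup.ind φ = RepGroup.ind φ' := by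
  refine RepGroup.hom_ext fun {V} _ _ _ ρ => ?_
  rw [RepGroup.ind_of, RepGroup.ind_of]
  have hh' (g) : φ g * h⁻¹ = h⁻¹ * φ' g := by
    rw [mul_inv_eq_iff_eq_mul, mul_assoc, hh, inv_mul_cancel_left]
  let F : IntertwiningMap (ρ.ind φ) (ρ.ind φ') :=
    indLift (ρ.ind φ' h⁻¹ ∘ₗ indMk φ' ρ) (fun g v => by
      rw [LinearMap.comp_apply, LinearMap.comp_apply, ind_mk_equivariant,
        rho_rho, rho_rho, hh'])
  let E : IntertwiningMap (ρ.ind φ') (ρ.ind φ) :=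
    indLift (ρ.ind φ h ∘ₗ indMk φ ρ) (fun g v => by
      rw [LinearMap.comp_apply, LinearMap.comp_apply, ind_mk_equivariant,
        rho_rho, rho_rho, hh])
  have hF (v) : F (indMk φ ρ v) = ρ.ind φ' h⁻¹ (indMk φ' ρ v) := indLift_mk _ _ _
  have hE (v) : E (indMk φ' ρ v) = ρ.ind φ h (indMk φ ρ v) := indLift_mk _ _ _
  refine RepGroup.of_congr F E (ind_ext fun v => ?_) (ind_ext fun v => ?_)
  · change E (F (indMk φ ρ v)) = indMk φ ρ v
    rw [hF, E.isIntertwining _ _ h⁻¹, hE, rho_rho, inv_mul_cancel, rho_one]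
  · change F (E (indMk φ' ρ v)) = indMk φ' ρ v
    rw [hE, F.isIntertwining _ _ h, hF, rho_rho, mul_inv_cancel, rho_one]

theorem RepGroup.of_ind_bijective [Finite G] [Finite H] (φ : G →* H) (hφ : Function.Surjective φ)
    (ρ : Representation ℚ G V) (τ : Representation ℚ H W) (f : V ≃ₗ[ℚ] W)
    (hf : ∀ g v, f (ρ g v) = τ (φ g) (f v)) : RepGroup.of (ρ.ind φ) = RepGroup.of τ := by
  let F : IntertwiningMap (ρ.ind φ) τ := indLift f.toLinearMap hf
  have hF (v) : F (indMk _ _ v) = f v := indLift_mk _ _ _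
  let E : IntertwiningMap τ (ρ.ind φ) :=
    (indMk φ ρ ∘ₗ f.symm.toLinearMap).intertwiningMap_of_isIntertwiningMap _ _ (fun h w => by
      obtain ⟨g, rfl⟩ := hφ h
      obtain ⟨v, rfl⟩ := f.surjective w
      change indMk φ ρ (f.symm _) = ρ.ind φ (φ g) (indMk φ ρ (f.symm _))
      rw [← hf, f.symm_apply_apply, f.symm_apply_apply, ind_mk_equivariant])
  have hE (w) : E w = indMk φ ρ (f.symm w) := rfl
  refine RepGroup.of_congr F E (ind_ext fun v => ?_) ?_
  · change E (F _) = indMk _ _ v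
    rw [hF, hE, f.symm_apply_apply]
  · ext w
    change F (E w) = w
    rw [hE, hF, f.apply_symm_apply]

end Ind

section Tensor

open TensorProduct

variable {V W X Y : Type} [AddCommGroup V] [Module ℚ V] [AddCommGroup W] [Module ℚ W]
  [AddCommGroup X] [Module ℚ X] [AddCommGroup Y] [Module ℚ Y]

/-- The external tensor product `V ⊠ W` of a representation of `G` and one of `H`,
a representation of `G × H`: `(g, h) (v ⊗ w) = g v ⊗ h w`. -/
noncomputable def extTensor (ρ : Representation ℚ G V) (τ : Representation ℚ H W) :
    Representation ℚ (G × H) (V ⊗[ℚ] W) :=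
  Representation.tprod (MonoidHom.comp ρ (MonoidHom.fst G H))
    (MonoidHom.comp τ (MonoidHom.snd G H))

theorem extTensor_tmul (ρ : Representation ℚ G V) (τ : Representation ℚ H W) (p : G × H)
    (v : V) (w : W) : extTensor ρ τ p (v ⊗ₜ w) = ρ p.1 v ⊗ₜ τ p.2 w := rfl

theorem tensor_ext {ρ : Representation ℚ G V} {τ : Representation ℚ H W}
    {π : Representation ℚ (G × H) X} {f g : IntertwiningMap (extTensor ρ τ) π}
    (h : ∀ v w, f (v ⊗ₜ w) = g (v ⊗ₜ w)) : f = g :=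
  IntertwiningMap.ext (TensorProduct.ext' h)

/-- Functoriality of the external tensor product. -/
noncomputable def extMap {ρ : Representation ℚ G V} {τ : Representation ℚ H W}
    {ρ' : Representation ℚ G X} {τ' : Representation ℚ H Y}
    (f : IntertwiningMap ρ ρ') (g : IntertwiningMap τ τ') :
    IntertwiningMap (extTensor ρ τ) (extTensor ρ' τ') :=
  ⟨TensorProduct.map f.toLinearMap g.toLinearMap, fun p => TensorProduct.ext' fun v w => by
    change f (ρ p.1 v) ⊗ₜ g (τ p.2 w) = ρ' p.1 (f v) ⊗ₜ τ' p.2 (g w)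
    rw [f.isIntertwining, g.isIntertwining]⟩

theorem extMap_tmul {ρ : Representation ℚ G V} {τ : Representation ℚ H W}
    {ρ' : Representation ℚ G X} {τ' : Representation ℚ H Y}
    (f : IntertwiningMap ρ ρ') (g : IntertwiningMap τ τ') (v : V) (w : W) :
    extMap f g (v ⊗ₜ w) = f v ⊗ₜ g w := rfl

variable [Module.Finite ℚ V] [Module.Finite ℚ W] [Module.Finite ℚ X]

/-- The map `[W] ↦ [V ⊠ W]` for a fixed representation `V`. -/
noncomputable def RepGroup.tensorRight [Finite H] (ρ : Representation ℚ G V) :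
    RepGroup H →+ RepGroup (G × H) :=
  RepGroup.lift (fun W => RepGroup.of (extTensor ρ W.ρ)) fun A B C f g r s h1 h2 h3 h4 => by
    have e1 (x) : r (f x) = x := congr($h1 x)
    have e2 (x) : g (s x) = x := congr($h2 x)
    have e3 (x) : g (f x) = 0 := congr($h3 x)
    have e4 (x) : f (r x) + s (g x) = x := congr($h4 x)
    refine RepGroup.of_split (extMap (.id ρ) f) (extMap (.id ρ) g) (extMap (.id ρ) r)
      (extMap (.id ρ) s)
      (tensor_ext fun v w => ?_) (tensor_ext fun v w => ?_) (tensor_ext fun v w => ?_)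
      (tensor_ext fun v w => ?_)
    · change v ⊗ₜ r (f w) = v ⊗ₜ w
      rw [e1]
    · change v ⊗ₜ g (s w) = v ⊗ₜ w
      rw [e2]
    · change v ⊗ₜ g (f w) = 0
      rw [e3, tmul_zero]
    · change v ⊗ₜ f (r w) + v ⊗ₜ s (g w) = v ⊗ₜ w
      rw [← tmul_add, e4]

theorem RepGroup.tensorRight_of [Finite H] (ρ : Representation ℚ G V)
    (τ : Representation ℚ H W) :
    RepGroup.tensorRight ρ (RepGroup.of τ) = RepGroup.of (extTensor ρ τ) := by
  unfold RepGroup.tensorRight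
  rw [RepGroup.lift_of]
  rfl

/-- The external product `R(G) × R(H) → R(G × H)`, `[V] ⊗ [W] ↦ [V ⊠ W]`. -/
noncomputable def RepGroup.tensor [Finite G] [Finite H] :
    RepGroup G →+ RepGroup H →+ RepGroup (G × H) :=
  RepGroup.lift (fun V => RepGroup.tensorRight V.ρ) fun A B C f g r s h1 h2 h3 h4 => by
    have e1 (x) : r (f x) = x := congr($h1 x)
    have e2 (x) : g (s x) = x := congr($h2 x)
    have e3 (x) : g (f x) = 0 := congr($h3 x)
    have e4 (x) : f (r x) + s (g x) = x := congr($h4 x)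
    refine RepGroup.hom_ext fun {V} _ _ _ ρ => ?_
    rw [AddMonoidHom.add_apply, RepGroup.tensorRight_of, RepGroup.tensorRight_of,
      RepGroup.tensorRight_of]
    refine RepGroup.of_split (extMap f (.id ρ)) (extMap g (.id ρ)) (extMap r (.id ρ))
      (extMap s (.id ρ))
      (tensor_ext fun v w => ?_) (tensor_ext fun v w => ?_) (tensor_ext fun v w => ?_)
      (tensor_ext fun v w => ?_)
    · change r (f v) ⊗ₜ w = v ⊗ₜ w
      rw [e1]
    · change g (s v) ⊗ₜ w = v ⊗ₜ w
      rw [e2]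
    · change g (f v) ⊗ₜ w = 0
      rw [e3, zero_tmul]
    · change f (r v) ⊗ₜ w + s (g v) ⊗ₜ w = v ⊗ₜ w
      rw [← add_tmul, e4]

theorem RepGroup.tensor_of [Finite G] [Finite H] (ρ : Representation ℚ G V)
    (τ : Representation ℚ H W) :
    RepGroup.tensor (RepGroup.of ρ) (RepGroup.of τ) = RepGroup.of (extTensor ρ τ) := by
  have : RepGroup.tensor (H := H) (RepGroup.of ρ) = RepGroup.tensorRight ρ :=
    RepGroup.lift_of (fun V => RepGroup.tensorRight V.ρ) _ ρ
  rw [this, RepGroup.tensorRight_of]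

theorem RepGroup.tensor_swap [Finite G] [Finite H] (x : RepGroup G) (y : RepGroup H) :
    RepGroup.ind (MulEquiv.prodComm : G × H ≃* H × G).toMonoidHom (RepGroup.tensor x y) =
      RepGroup.tensor y x := by
  suffices (AddMonoidHom.compr₂ (RepGroup.tensor (G := G) (H := H))
      (RepGroup.ind (MulEquiv.prodComm : G × H ≃* H × G).toMonoidHom)) = RepGroup.tensor.flip from
    congr($this x y)
  refine RepGroup.hom_ext fun {V} _ _ _ ρ => RepGroup.hom_ext fun {W} _ _ _ τ => ?_
  rw [AddMonoidHom.compr₂_apply, AddMonoidHom.flip_apply, RepGroup.tensor_of,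
    RepGroup.tensor_of, RepGroup.ind_of]
  refine RepGroup.of_ind_bijective _ MulEquiv.prodComm.surjective _ _
    (TensorProduct.comm ℚ V W) fun p v => ?_
  induction v using TensorProduct.induction_on with
  | zero => rw [map_zero, map_zero, map_zero]
  | add a b ha hb => rw [map_add, map_add, ha, hb, map_add, map_add]
  | tmul a b => rfl

theorem RepGroup.tensor_assoc [Finite G] [Finite H] [Finite K]
    (x : RepGroup G) (y : RepGroup H) (z : RepGroup K) :
    RepGroup.ind (MulEquiv.prodAssoc : (G × H) × K ≃* G × H × K).toMonoidHom
      (RepGroup.tensor (RepGroup.tensor x y) z) = RepGroup.tensor x (RepGroup.tensor y z) := by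
  suffices h : ∀ {U : Type} [AddCommGroup U] [Module ℚ U] [Module.Finite ℚ U]
      (ρ : Representation ℚ G U) {V : Type} [AddCommGroup V] [Module ℚ V] [Module.Finite ℚ V]
      (σ : Representation ℚ H V) {W : Type} [AddCommGroup W] [Module ℚ W] [Module.Finite ℚ W]
      (τ : Representation ℚ K W),
      RepGroup.ind (MulEquiv.prodAssoc : (G × H) × K ≃* G × H × K).toMonoidHom
        (RepGroup.tensor (RepGroup.tensor (.of ρ) (.of σ)) (.of τ)) =
        RepGroup.tensor (.of ρ) (RepGroup.tensor (.of σ) (.of τ)) by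
    let L : RepGroup G →+ RepGroup H →+ RepGroup K →+ RepGroup (G × H × K) :=
      (RepGroup.tensor (G := G) (H := H)).compr₂ (RepGroup.tensor.compr₂
        (RepGroup.ind (MulEquiv.prodAssoc : (G × H) × K ≃* G × H × K).toMonoidHom))
    let R : RepGroup G →+ RepGroup H →+ RepGroup K →+ RepGroup (G × H × K) :=
      AddMonoidHom.mk' (fun x => (RepGroup.tensor (G := H) (H := K)).compr₂ (RepGroup.tensor x))
        (fun a b => by ext; simp)
    have hLR : L = R := RepGroup.hom_ext fun ρ => RepGroup.hom_ext fun σ => RepGroup.hom_ext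
      fun τ => h ρ σ τ
    exact congr($hLR x y z)
  intro U _ _ _ ρ V _ _ _ σ W _ _ _ τ
  rw [RepGroup.tensor_of, RepGroup.tensor_of, RepGroup.tensor_of, RepGroup.tensor_of,
    RepGroup.ind_of]
  refine RepGroup.of_ind_bijective _ MulEquiv.prodAssoc.surjective _ _
    (TensorProduct.assoc ℚ U V W) fun p v => ?_
  revert v
  refine fun v => LinearMap.congr_fun (f := (TensorProduct.assoc ℚ U V W).toLinearMap ∘ₗ
    extTensor (extTensor ρ σ) τ p) (g := extTensor ρ (extTensor σ τ) (MulEquiv.prodAssoc p) ∘ₗ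
    (TensorProduct.assoc ℚ U V W).toLinearMap) (TensorProduct.ext_threefold fun a b c => ?_) v
  rfl

theorem RepGroup.tensor_ind_left [Finite G] [Finite H] [Finite K] (φ : G →* H)
    (x : RepGroup G) (y : RepGroup K) :
    RepGroup.tensor (RepGroup.ind φ x) y =
      RepGroup.ind (φ.prodMap (MonoidHom.id K)) (RepGroup.tensor x y) := by
  suffices (RepGroup.tensor (H := K)).comp (RepGroup.ind φ) =
      RepGroup.tensor.compr₂ (RepGroup.ind (φ.prodMap (MonoidHom.id K))) from congr($this x y)
  refine RepGroup.hom_ext fun {V} _ _ _ ρ => RepGroup.hom_ext fun {W} _ _ _ τ => ?_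
  rw [AddMonoidHom.comp_apply, AddMonoidHom.compr₂_apply, RepGroup.tensor_of, RepGroup.ind_of,
    RepGroup.ind_of, RepGroup.tensor_of]
  let ψ := φ.prodMap (MonoidHom.id K)
  let π := (extTensor ρ τ).ind ψ
  -- the representation of `H` on `Hom(W, Ind (V ⊠ W))` through the action on the target
  let η : Representation ℚ H (W →ₗ[ℚ] IndV ψ (extTensor ρ τ)) :=
    { toFun := fun h => LinearMap.llcomp ℚ W _ _ (π (h, 1))
      map_one' := by
        ext f w
        exact rho_one π _
      map_mul' := fun a b => by
        ext f w
        change π (a * b, 1) (f w) = π (a, 1) (π (b, 1) (f w))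
        rw [rho_rho, Prod.mk_mul_mk, mul_one] }
  let F₀ : IntertwiningMap (ρ.ind φ) η :=
    indLift ((TensorProduct.mk ℚ V W).compr₂ (indMk ψ (extTensor ρ τ))) (fun g v => by
      ext w
      change indMk ψ (extTensor ρ τ) (ρ g v ⊗ₜ w) =
        π (φ g, 1) (indMk ψ (extTensor ρ τ) (v ⊗ₜ w))
      have := ind_mk_equivariant ψ (extTensor ρ τ) (g, 1) (v ⊗ₜ w)
      rw [extTensor_tmul, rho_one] at this
      exact this)
  have hF₀ (v w) : F₀ (indMk φ ρ v) w = indMk ψ (extTensor ρ τ) (v ⊗ₜ w) :=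
    LinearMap.congr_fun (indLift_mk (φ := φ) (ρ := ρ) (τ := η) _ _ v) w
  have hF₁ (h : H) (x) (w) : F₀ (ρ.ind φ h x) w = π (h, 1) (F₀ x w) :=
    congr($(F₀.isIntertwining _ _ h x) w)
  have hF₂ (k : K) (x) (w) : F₀ x (τ k w) = π (1, k) (F₀ x w) := by
    let A : IntertwiningMap (ρ.ind φ) η :=
      LinearMap.intertwiningMap_of_isIntertwiningMap _ _
        (LinearMap.lcomp ℚ _ (τ k) ∘ₗ F₀.toLinearMap) (fun h x => by
          ext w
          exact hF₁ h x (τ k w))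
    let B : IntertwiningMap (ρ.ind φ) η :=
      LinearMap.intertwiningMap_of_isIntertwiningMap _ _
        (LinearMap.llcomp ℚ W _ _ (π (1, k)) ∘ₗ F₀.toLinearMap) (fun h x => by
          ext w
          change π (1, k) (F₀ (ρ.ind φ h x) w) = π (h, 1) (π (1, k) (F₀ x w))
          rw [hF₁, rho_rho, rho_rho, Prod.mk_mul_mk, Prod.mk_mul_mk, mul_one, mul_one, one_mul,
            one_mul])
    have hAB : A = B := ind_ext fun v => by
      ext w
      change F₀ (indMk φ ρ v) (τ k w) = π (1, k) (F₀ (indMk φ ρ v) w)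
      rw [hF₀, hF₀]
      have := ind_mk_equivariant ψ (extTensor ρ τ) (1, k) (v ⊗ₜ w)
      rw [extTensor_tmul, rho_one] at this
      rw [this]
      congr 2
      exact Prod.ext (map_one φ) rfl
    exact congr($hAB x w)
  let F : IntertwiningMap (extTensor (ρ.ind φ) τ) π :=
    LinearMap.intertwiningMap_of_isIntertwiningMap _ _ (TensorProduct.lift F₀.toLinearMap)
      (fun p x => by
        refine LinearMap.congr_fun (f := TensorProduct.lift F₀.toLinearMap ∘ₗ
          extTensor (ρ.ind φ) τ p) (g := π p ∘ₗ TensorProduct.lift F₀.toLinearMap)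
          (TensorProduct.ext' fun y w => ?_) x
        change F₀ (ρ.ind φ p.1 y) (τ p.2 w) = π p (F₀ y w)
        rw [hF₁, hF₂, rho_rho, Prod.mk_mul_mk, mul_one, one_mul])
  have hF (y w) : F (y ⊗ₜ w) = F₀ y w := rfl
  let E : IntertwiningMap π (extTensor (ρ.ind φ) τ) :=
    indLift (TensorProduct.map (indMk φ ρ) LinearMap.id) (fun p x => by
      refine LinearMap.congr_fun (f := TensorProduct.map (indMk φ ρ) LinearMap.id ∘ₗ
          extTensor ρ τ p) (g := extTensor (ρ.ind φ) τ (ψ p) ∘ₗ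
          TensorProduct.map (indMk φ ρ) LinearMap.id) (TensorProduct.ext' fun v w => ?_) x
      change indMk φ ρ (ρ p.1 v) ⊗ₜ τ p.2 w = ρ.ind φ (φ p.1) (indMk φ ρ v) ⊗ₜ τ p.2 w
      rw [ind_mk_equivariant])
  have hE (v w) : E (indMk ψ (extTensor ρ τ) (v ⊗ₜ w)) = indMk φ ρ v ⊗ₜ w :=
    indLift_mk (φ := ψ) (ρ := extTensor ρ τ) (τ := extTensor (ρ.ind φ) τ) _ _ _
  refine RepGroup.of_congr F E (tensor_ext fun y w => ?_) (ind_ext fun x => ?_)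
  · change E (F₀ y w) = y ⊗ₜ w
    let A : IntertwiningMap (ρ.ind φ) (MonoidHom.comp (extTensor (ρ.ind φ) τ)
        (MonoidHom.inl H K)) :=
      LinearMap.intertwiningMap_of_isIntertwiningMap _ _
        (E.toLinearMap ∘ₗ F₀.toLinearMap.flip w) (fun h x => by
          change E (F₀ (ρ.ind φ h x) w) = extTensor (ρ.ind φ) τ (h, 1) (E (F₀ x w))
          rw [hF₁, E.isIntertwining])
    let B : IntertwiningMap (ρ.ind φ) (MonoidHom.comp (extTensor (ρ.ind φ) τ)
        (MonoidHom.inl H K)) :=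
      LinearMap.intertwiningMap_of_isIntertwiningMap _ _
        ((TensorProduct.mk ℚ _ W).flip w) (fun h x => by
          change ρ.ind φ h x ⊗ₜ w = ρ.ind φ h x ⊗ₜ τ 1 w
          rw [rho_one])
    have hAB : A = B := ind_ext fun v => by
      change E (F₀ (indMk φ ρ v) w) = indMk φ ρ v ⊗ₜ w
      rw [hF₀, hE]
    exact congr($hAB y)
  · change F (E (indMk ψ (extTensor ρ τ) x)) = indMk ψ (extTensor ρ τ) x
    refine LinearMap.congr_fun (f := F.toLinearMap ∘ₗ E.toLinearMap ∘ₗ indMk ψ (extTensor ρ τ))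
      (TensorProduct.ext' fun v w => ?_) x
    change F (E (indMk ψ (extTensor ρ τ) (v ⊗ₜ w))) = _
    rw [hE, hF, hF₀]

end Tensor
end RepGroup

section CompletedRing

open Finset.HasAntidiagonal (antidiagonal mem_antidiagonal)

/-- The embedding `S_α × S_β → S_γ` determined by a bijection `α ⊔ β ≃ γ`. -/
def sumPermHom {α β γ : Type} (e : α ⊕ β ≃ γ) :
    Equiv.Perm α × Equiv.Perm β →* Equiv.Perm γ :=
  e.permCongrHom.toMonoidHom.comp (Equiv.Perm.sumCongrHom α β)

theorem sumPermHom_inl {α β γ : Type} (e : α ⊕ β ≃ γ) (p : Equiv.Perm α × Equiv.Perm β) (a : α) :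
    sumPermHom e p (e (Sum.inl a)) = e (Sum.inl (p.1 a)) := by
  simp [sumPermHom]

theorem sumPermHom_inr {α β γ : Type} (e : α ⊕ β ≃ γ) (p : Equiv.Perm α × Equiv.Perm β) (b : β) :
    sumPermHom e p (e (Sum.inr b)) = e (Sum.inr (p.2 b)) := by
  simp [sumPermHom]

/-- For `i + j = n`, the standard embedding `S_i × S_j → S_n`, where `S_i` permutes the first `i`
elements and `S_j` permutes the last `j` elements. -/
def youngHom {i j n : ℕ} (h : i + j = n) :
    Equiv.Perm (Fin i) × Equiv.Perm (Fin j) →* Equiv.Perm (Fin n) :=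
  sumPermHom (finSumFinEquiv.trans (finCongr h))

/-- The induction product `R(S_i) × R(S_j) → R(S_n)` for `i + j = n`,
`[V] · [W] = [Ind_{S_i × S_j}^{S_n} (V ⊠ W)]`. -/
noncomputable def indProd {i j n : ℕ} (h : i + j = n) :
    RepGroup (Equiv.Perm (Fin i)) →+ RepGroup (Equiv.Perm (Fin j)) →+
      RepGroup (Equiv.Perm (Fin n)) :=
  RepGroup.tensor.compr₂ (RepGroup.ind (youngHom h))

theorem indProd_apply {i j n : ℕ} (h : i + j = n) (x : RepGroup (Equiv.Perm (Fin i)))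
    (y : RepGroup (Equiv.Perm (Fin j))) :
    indProd h x y = RepGroup.ind (youngHom h) (RepGroup.tensor x y) := rfl

theorem RepGroup.ind_perm {G α β : Type} [Group G] [Finite G] [Finite α] [Finite β]
    (φ φ' : G →* Equiv.Perm α) (u u' : β ≃ α) (h : ∀ g x y, φ g (u x) = u y → φ' g (u' x) = u' y) :
    RepGroup.ind φ = RepGroup.ind φ' := by
  refine RepGroup.ind_conj φ φ' (u.symm.trans u') fun g => Equiv.ext fun x => ?_
  obtain ⟨x, rfl⟩ := u.surjective x
  obtain ⟨y, hy⟩ := u.surjective (φ g (u x))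
  rw [Equiv.Perm.mul_apply, Equiv.Perm.mul_apply, ← hy]
  simpa using h g x y hy.symm

theorem indProd_comm {i j n : ℕ} (h : i + j = n) (h' : j + i = n)
    (x : RepGroup (Equiv.Perm (Fin i))) (y : RepGroup (Equiv.Perm (Fin j))) :
    indProd h x y = indProd h' y x := by
  rw [indProd_apply, indProd_apply, ← RepGroup.tensor_swap x y, RepGroup.ind_ind]
  refine DFunLike.congr_fun (RepGroup.ind_perm _ _ (finSumFinEquiv.trans (finCongr h))
    ((Equiv.sumComm _ _).trans (finSumFinEquiv.trans (finCongr h'))) ?_) _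
  rintro g (a | b) y hy
  · rw [youngHom, sumPermHom_inl] at hy
    rw [← (Equiv.injective _ hy)]
    exact sumPermHom_inr _ _ _
  · rw [youngHom, sumPermHom_inr] at hy
    rw [← (Equiv.injective _ hy)]
    exact sumPermHom_inl _ _ _

theorem indProd_assoc {i j k m l n : ℕ} (h₁ : i + j = m) (h₂ : m + k = n) (h₃ : j + k = l)
    (h₄ : i + l = n) (x : RepGroup (Equiv.Perm (Fin i))) (y : RepGroup (Equiv.Perm (Fin j)))
    (z : RepGroup (Equiv.Perm (Fin k))) :
    indProd h₂ (indProd h₁ x y) z = indProd h₄ x (indProd h₃ y z) := by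
  rw [indProd_comm h₄ (by omega) x, indProd_apply, indProd_apply, indProd_apply, indProd_apply,
    RepGroup.tensor_ind_left, RepGroup.tensor_ind_left, RepGroup.ind_ind, RepGroup.ind_ind,
    ← RepGroup.tensor_swap x, ← RepGroup.tensor_assoc x, RepGroup.ind_ind, RepGroup.ind_ind]
  let e₁ := finSumFinEquiv.trans (finCongr h₁)
  let e₂ := finSumFinEquiv.trans (finCongr h₂)
  let e₃ := finSumFinEquiv.trans (finCongr h₃)
  let e₄ := finSumFinEquiv.trans (finCongr (show l + i = n by omega))
  refine DFunLike.congr_fun (RepGroup.ind_perm _ _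
    ((Equiv.sumCongr e₁ (Equiv.refl _)).trans e₂)
    ((Equiv.sumAssoc _ _ _).trans ((Equiv.sumComm _ _).trans
      ((Equiv.sumCongr e₃ (Equiv.refl _)).trans e₄))) ?_) _
  rintro ⟨⟨a, b⟩, c⟩ x y hy
  have key : y = Equiv.Perm.sumCongr (Equiv.Perm.sumCongr a b) c x := by
    apply ((Equiv.sumCongr e₁ (Equiv.refl _)).trans e₂).injective
    rw [← hy]
    rcases x with (x | x) | x
    · exact (sumPermHom_inl e₂ (sumPermHom e₁ (a, b), c) _).trans
        (congrArg (fun t => e₂ (Sum.inl t)) (sumPermHom_inl e₁ (a, b) x))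
    · exact (sumPermHom_inl e₂ (sumPermHom e₁ (a, b), c) _).trans
        (congrArg (fun t => e₂ (Sum.inl t)) (sumPermHom_inr e₁ (a, b) x))
    · exact sumPermHom_inr e₂ (sumPermHom e₁ (a, b), c) x
  rw [key]
  rcases x with (x | x) | x
  · exact sumPermHom_inr e₄ (sumPermHom e₃ (b, c), a) x
  · exact (sumPermHom_inl e₄ (sumPermHom e₃ (b, c), a) _).trans
      (congrArg (fun t => e₄ (Sum.inl t)) (sumPermHom_inl e₃ (b, c) x))
  · exact (sumPermHom_inl e₄ (sumPermHom e₃ (b, c), a) _).trans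
      (congrArg (fun t => e₄ (Sum.inl t)) (sumPermHom_inr e₃ (b, c) x))

/-- The class `1_{S_n}` of the trivial representation of `S_n`. -/
noncomputable def trivialClass (n : ℕ) : RepGroup (Equiv.Perm (Fin n)) :=
  RepGroup.of (Representation.trivial ℚ (Equiv.Perm (Fin n)) ℚ)

theorem one_indProd {n : ℕ} (h : 0 + n = n) (x : RepGroup (Equiv.Perm (Fin n))) :
    indProd h (trivialClass 0) x = x := by
  suffices indProd h (trivialClass 0) = AddMonoidHom.id _ from congr($this x)
  refine RepGroup.hom_ext fun {V} _ _ _ ρ => ?_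
  rw [indProd_apply, trivialClass, RepGroup.tensor_of]
  have : RepGroup.ind (youngHom h) =
      RepGroup.ind (MonoidHom.snd (Equiv.Perm (Fin 0)) (Equiv.Perm (Fin n))) := by
    refine RepGroup.ind_perm _ _ (finSumFinEquiv.trans (finCongr h))
      (Equiv.emptySum (Fin 0) (Fin n)) ?_
    rintro g (a | b) y hy
    · exact a.elim0
    · rw [youngHom, sumPermHom_inr] at hy
      rw [← (Equiv.injective _ hy)]
      rfl
  rw [this, RepGroup.ind_of]
  refine RepGroup.of_ind_bijective _ Prod.snd_surjective _ _ (TensorProduct.lid ℚ V) fun p v => ?_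
  refine LinearMap.congr_fun (f := (TensorProduct.lid ℚ V).toLinearMap ∘ₗ
    extTensor (Representation.trivial ℚ (Equiv.Perm (Fin 0)) ℚ) ρ p) (g := ρ p.2 ∘ₗ
    (TensorProduct.lid ℚ V).toLinearMap) (TensorProduct.ext' fun a b => ?_) v
  change a • ρ p.2 b = ρ p.2 (a • b)
  rw [map_smul]

/-- The completion `R` of the graded ring `⨁_{n ≥ 0} R(S_n)`: an element is a formal sum
`∑_{n ≥ 0} a_n` with `a_n ∈ R(S_n)`, given by its components. -/
def CompletedRing : Type 1 := ∀ n : ℕ, RepGroup (Equiv.Perm (Fin n))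

namespace CompletedRing

noncomputable instance : AddCommGroup CompletedRing :=
  inferInstanceAs (AddCommGroup (∀ n : ℕ, RepGroup (Equiv.Perm (Fin n))))

/-- The formal sum `∑_{n ≥ 0} a_n`, with `a_n ∈ R(S_n)`. -/
def formalSum (a : ∀ n : ℕ, RepGroup (Equiv.Perm (Fin n))) : CompletedRing := a

/-- The identity element `1 = 1_{S_0}`. -/
noncomputable instance : One CompletedRing := ⟨formalSum (Pi.single 0 (trivialClass 0))⟩

/-- The induction product, `(a b)_n = ∑_{i + j = n} Ind_{S_i × S_j}^{S_n} (a_i ⊠ b_j)`. -/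
noncomputable instance : Mul CompletedRing :=
  ⟨fun a b => formalSum fun n =>
    ∑ p : antidiagonal n, indProd (mem_antidiagonal.1 p.2) (a p.1.1) (b p.1.2)⟩

theorem ext {a b : CompletedRing} (h : ∀ n, a n = b n) : a = b := funext h

theorem add_coeff (a b : CompletedRing) (n : ℕ) : (a + b) n = a n + b n := rfl

theorem mul_coeff (a b : CompletedRing) (n : ℕ) :
    (a * b) n = ∑ p : antidiagonal n, indProd (mem_antidiagonal.1 p.2) (a p.1.1) (b p.1.2) := rfl

theorem mul_coeff' (a b : CompletedRing) (n : ℕ) :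
    (a * b) n = ∑ p ∈ antidiagonal n,
      if h : p.1 + p.2 = n then indProd h (a p.1) (b p.2) else 0 := by
  rw [mul_coeff, ← Finset.sum_coe_sort (antidiagonal n)]
  refine Finset.sum_congr rfl fun p _ => ?_
  rw [dif_pos (mem_antidiagonal.1 p.2)]

protected theorem mul_comm (a b : CompletedRing) : a * b = b * a := by
  refine ext fun n => ?_
  rw [mul_coeff', mul_coeff', ← Finset.Nat.sum_antidiagonal_swap]
  refine Finset.sum_congr rfl fun p hp => ?_
  have h := mem_antidiagonal.1 hp
  rw [dif_pos h, dif_pos (show p.swap.1 + p.swap.2 = n by rw [← h, add_comm]; rfl)]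
  exact indProd_comm _ _ _ _

protected theorem one_mul (a : CompletedRing) : 1 * a = a := by
  refine ext fun n => ?_
  rw [mul_coeff', Finset.sum_eq_single (0, n)]
  · rw [dif_pos (zero_add n)]
    exact one_indProd _ _
  · rintro ⟨i, j⟩ hp hne
    have h := mem_antidiagonal.1 hp
    have hi : i ≠ 0 := by
      rintro rfl
      simp_all
    rw [dif_pos h]
    have : (1 : CompletedRing) i = 0 := Pi.single_eq_of_ne hi _
    rw [this, map_zero, AddMonoidHom.zero_apply]
  · intro hn
    simp at hn

protected theorem mul_assoc (a b c : CompletedRing) : a * b * c = a * (b * c) := by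
  refine ext fun n => ?_
  let T (i j k : ℕ) : RepGroup (Equiv.Perm (Fin n)) :=
    if h : (i + j) + k = n then indProd h (indProd rfl (a i) (b j)) (c k) else 0
  have h1 : (a * b * c) n =
      ∑ p ∈ antidiagonal n, ∑ q ∈ antidiagonal p.1, T q.1 q.2 p.2 := by
    rw [mul_coeff']
    refine Finset.sum_congr rfl fun p hp => ?_
    have h := mem_antidiagonal.1 hp
    rw [dif_pos h, mul_coeff', map_sum, AddMonoidHom.finsetSum_apply]
    refine Finset.sum_congr rfl fun q hq => ?_
    obtain ⟨p1, p2⟩ := p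
    have h' := mem_antidiagonal.1 hq
    dsimp only at h' h ⊢
    subst h'
    rw [dif_pos rfl]
    simp only [T]
    rw [dif_pos h]
  have h2 : (a * (b * c)) n =
      ∑ p ∈ antidiagonal n, ∑ q ∈ antidiagonal p.2, T p.1 q.1 q.2 := by
    rw [mul_coeff']
    refine Finset.sum_congr rfl fun p hp => ?_
    have h := mem_antidiagonal.1 hp
    rw [dif_pos h, mul_coeff', map_sum]
    refine Finset.sum_congr rfl fun q hq => ?_
    have h' := mem_antidiagonal.1 hq
    have h'' : (p.1 + q.1) + q.2 = n := by omega
    rw [dif_pos h']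
    refine Eq.trans ?_ (dif_pos h'').symm
    exact (indProd_assoc _ _ _ _ _ _ _).symm
  rw [h1, h2, Finset.sum_sigma', Finset.sum_sigma']
  refine Finset.sum_nbij' (fun x => ⟨(x.2.1, x.2.2 + x.1.2), (x.2.2, x.1.2)⟩)
    (fun x => ⟨(x.1.1 + x.2.1, x.2.2), (x.1.1, x.2.1)⟩) ?_ ?_ ?_ ?_ ?_
  · rintro ⟨⟨i, j⟩, ⟨k, l⟩⟩ hx
    simp only [Finset.mem_sigma, mem_antidiagonal] at hx ⊢
    obtain ⟨hx₁, hx₂⟩ := hx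
    subst hx₁ hx₂
    exact ⟨by ring, trivial⟩
  · rintro ⟨⟨i, j⟩, ⟨k, l⟩⟩ hx
    simp only [Finset.mem_sigma, mem_antidiagonal] at hx ⊢
    obtain ⟨hx₁, hx₂⟩ := hx
    subst hx₁ hx₂
    exact ⟨by ring, trivial⟩
  · rintro ⟨⟨i, j⟩, ⟨k, l⟩⟩ hx
    simp only [Finset.mem_sigma, mem_antidiagonal] at hx
    obtain ⟨_, rfl⟩ := hx
    rfl
  · rintro ⟨⟨i, j⟩, ⟨k, l⟩⟩ hx
    simp only [Finset.mem_sigma, mem_antidiagonal] at hx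
    obtain ⟨_, rfl⟩ := hx
    rfl
  · rintro ⟨⟨i, j⟩, ⟨k, l⟩⟩ hx
    rfl

protected theorem left_distrib (a b c : CompletedRing) : a * (b + c) = a * b + a * c := by
  refine ext fun n => ?_
  rw [add_coeff, mul_coeff, mul_coeff, mul_coeff, ← Finset.sum_add_distrib]
  exact Finset.sum_congr rfl fun p _ => by rw [add_coeff, map_add]

protected theorem right_distrib (a b c : CompletedRing) : (a + b) * c = a * c + b * c := by
  rw [CompletedRing.mul_comm, CompletedRing.left_distrib, CompletedRing.mul_comm c,
    CompletedRing.mul_comm c]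

protected theorem zero_mul (a : CompletedRing) : 0 * a = 0 := by
  have := CompletedRing.right_distrib 0 0 a
  rwa [add_zero, left_eq_add] at this

noncomputable instance : CommRing CompletedRing :=
  { (inferInstance : AddCommGroup CompletedRing), (inferInstance : One CompletedRing),
    (inferInstance : Mul CompletedRing) with
    mul_comm := CompletedRing.mul_comm
    mul_assoc := CompletedRing.mul_assoc
    one_mul := CompletedRing.one_mul
    mul_one := fun a => by rw [CompletedRing.mul_comm, CompletedRing.one_mul]
    left_distrib := CompletedRing.left_distrib
    right_distrib := CompletedRing.right_distrib
    zero_mul := CompletedRing.zero_mul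
    mul_zero := fun a => by rw [CompletedRing.mul_comm, CompletedRing.zero_mul] }

end CompletedRing

end CompletedRing

section PosetHomology

variable (P : Type) [PartialOrder P]

/-- The space of `k`-element chains `x_0 < ⋯ < x_{k-1}` of a poset `P` with coefficients in `ℚ`,
that is, the space of `(k-1)`-dimensional chains of the order complex of `P`. For `k = 0` it is
`ℚ`, spanned by the empty chain. -/
abbrev ChainSpace (k : ℕ) : Type := (Fin k ↪o P) →₀ ℚ

instance [Finite P] (k : ℕ) : Module.Finite ℚ (ChainSpace P k) := by
  have : Finite (Fin k ↪o P) := DFunLike.finite _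
  infer_instance

/-- The simplicial boundary map of the augmented chain complex of the order complex of `P`:
`∂ (x_0 < ⋯ < x_k) = ∑_i (-1)^i (x_0 < ⋯ < x̂_i < ⋯ < x_k)`. For `k = 0` it is the
augmentation. -/
noncomputable def boundary (k : ℕ) : ChainSpace P (k + 1) →ₗ[ℚ] ChainSpace P k :=
  Finsupp.linearCombination ℚ fun c : Fin (k + 1) ↪o P =>
    ∑ i : Fin (k + 1), (-1 : ℚ) ^ (i : ℕ) •
      Finsupp.single ((Fin.succAboveOrderEmb i).trans c) (1 : ℚ)

/-- The cycles spanned by `k`-element chains. -/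
noncomputable def cycles : (k : ℕ) → Submodule ℚ (ChainSpace P k)
  | 0 => ⊤
  | k + 1 => LinearMap.ker (boundary P k)

/-- The boundaries of `(k+1)`-element chains, viewed inside the cycles. -/
noncomputable def boundaries (k : ℕ) : Submodule ℚ (cycles P k) :=
  (LinearMap.range (boundary P k)).submoduleOf (cycles P k)

/-- The reduced homology `H̃_{k-1}(P; ℚ)` of the order complex of `P`. -/
abbrev PosetHomology (k : ℕ) : Type := cycles P k ⧸ boundaries P k

/-- The action of the automorphisms of `P` on chains, `g (x_0 < ⋯) = (g x_0 < ⋯)`. -/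
noncomputable def chainRep (k : ℕ) : Representation ℚ (P ≃o P) (ChainSpace P k) where
  toFun g := Finsupp.lmapDomain ℚ ℚ fun c => c.trans g.toOrderEmbedding
  map_one' := by
    ext c : 1
    exact LinearMap.ext_ring (Finsupp.mapDomain_single ..)
  map_mul' g h := by
    ext c : 1
    refine LinearMap.ext_ring ?_
    change Finsupp.mapDomain _ (Finsupp.single _ _) =
      Finsupp.mapDomain _ (Finsupp.mapDomain _ (Finsupp.single _ _))
    rw [Finsupp.mapDomain_single, Finsupp.mapDomain_single, Finsupp.mapDomain_single]
    rfl

theorem chainRep_single (k : ℕ) (g : P ≃o P) (c : Fin k ↪o P) (a : ℚ) :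
    chainRep P k g (Finsupp.single c a) = Finsupp.single (c.trans g.toOrderEmbedding) a :=
  Finsupp.mapDomain_single ..

theorem boundary_single (k : ℕ) (c : Fin (k + 1) ↪o P) :
    boundary P k (Finsupp.single c 1) = ∑ i : Fin (k + 1), (-1 : ℚ) ^ (i : ℕ) •
      Finsupp.single ((Fin.succAboveOrderEmb i).trans c) (1 : ℚ) := by
  rw [boundary, Finsupp.linearCombination_single, one_smul]

/-- Consecutive boundary maps compose to zero. -/
theorem boundary_boundary (k : ℕ) (x : ChainSpace P (k + 2)) :
    boundary P k (boundary P (k + 1) x) = 0 := by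
  suffices h : boundary P k ∘ₗ boundary P (k + 1) = 0 from LinearMap.congr_fun h x
  ext c : 1
  refine LinearMap.ext_ring ?_
  change boundary P k (boundary P (k + 1) (Finsupp.single c 1)) = 0
  simp only [boundary_single, map_sum, map_smul, Finset.smul_sum, smul_smul, ← pow_add]
  rw [← Finset.sum_product']
  refine Finset.sum_involution (fun x _ => if h : (x.2 : Fin (k + 1)).castSucc < x.1 then
      (x.2.castSucc, x.1.pred (Fin.ne_zero_of_lt h)) else (x.2.succ, x.1.castPred (by
        intro e; apply h; rw [e]; exact Fin.castSucc_lt_last _))) ?_ ?_ ?_ ?_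
  · rintro ⟨i, j⟩ _
    have hc : ∀ i' j', ((Fin.succAboveOrderEmb j).trans (Fin.succAboveOrderEmb i)) =
        ((Fin.succAboveOrderEmb j').trans (Fin.succAboveOrderEmb i')) →
        (Fin.succAboveOrderEmb j).trans ((Fin.succAboveOrderEmb i).trans c) =
        (Fin.succAboveOrderEmb j').trans ((Fin.succAboveOrderEmb i').trans c) := by
      intro i' j' e
      ext m
      exact congrArg c (DFunLike.congr_fun e m)
    by_cases h : j.castSucc < i
    · rw [dif_pos h]
      rw [hc j.castSucc (i.pred (Fin.ne_zero_of_lt h)) ?_, ← add_smul]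
      · have : (i : ℕ) + j = (j + (i.pred (Fin.ne_zero_of_lt h) : ℕ)) + 1 := by
          have := Fin.lt_def.1 h
          simp at this ⊢; omega
        dsimp only
        rw [this, pow_succ, Fin.val_castSucc, mul_neg_one, neg_add_cancel, zero_smul]
      · ext m
        obtain ⟨i, hi⟩ := i
        obtain ⟨j, hj⟩ := j
        obtain ⟨m, hm⟩ := m
        have := Fin.lt_def.1 h
        simp only [RelEmbedding.trans_apply, Fin.succAboveOrderEmb_apply, Fin.succAbove, Fin.lt_def, Fin.val_castSucc, Fin.pred_mk] at this ⊢
        split_ifs <;> simp only [Fin.val_castSucc, Fin.val_succ] at * <;> omega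
    · rw [dif_neg h]
      rw [hc j.succ (i.castPred (by
        intro e; apply h; rw [e]; exact Fin.castSucc_lt_last _)) ?_, ← add_smul]
      · dsimp only
        rw [Fin.val_succ, Fin.coe_castPred, add_comm (j + 1 : ℕ), ← add_assoc, pow_succ,
          mul_neg_one, add_neg_cancel, zero_smul]
      · ext m
        obtain ⟨i, hi⟩ := i
        obtain ⟨j, hj⟩ := j
        obtain ⟨m, hm⟩ := m
        have hij : i ≤ j := not_lt.1 fun e => h (Fin.lt_def.2 e)
        simp only [RelEmbedding.trans_apply, Fin.succAboveOrderEmb_apply, Fin.succAbove, Fin.lt_def, Fin.val_castSucc, Fin.val_succ, Fin.coe_castPred]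
        split_ifs <;> simp only [Fin.val_castSucc, Fin.val_succ] at * <;> omega
  · rintro ⟨i, j⟩ _ _ e
    dsimp only at e
    split_ifs at e with h <;> simp [Fin.ext_iff, Fin.lt_def] at e h <;> omega
  · intros
    simp
  · rintro ⟨i, j⟩ _
    dsimp only
    split_ifs with h1 h2 h2 <;> simp [Fin.ext_iff, Fin.lt_def] at h1 h2 ⊢ <;> omega

theorem boundary_chainRep (k : ℕ) (g : P ≃o P) (x : ChainSpace P (k + 1)) :
    boundary P k (chainRep P (k + 1) g x) = chainRep P k g (boundary P k x) := by
  suffices h : boundary P k ∘ₗ chainRep P (k + 1) g = chainRep P k g ∘ₗ boundary P k from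
    LinearMap.congr_fun h x
  ext c : 1
  refine LinearMap.ext_ring ?_
  change boundary P k (chainRep P (k + 1) g (Finsupp.single c 1)) =
    chainRep P k g (boundary P k (Finsupp.single c 1))
  rw [chainRep_single, boundary_single, boundary_single, map_sum]
  refine Finset.sum_congr rfl fun i _ => ?_
  rw [map_smul, chainRep_single]
  rfl

theorem chainRep_mem_cycles (k : ℕ) (g : P ≃o P) (x : ChainSpace P k) (hx : x ∈ cycles P k) :
    chainRep P k g x ∈ cycles P k := by
  cases k with
  | zero => trivial
  | succ k =>
    change boundary P k _ = 0
    rw [boundary_chainRep, show boundary P k x = 0 from hx, map_zero]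

/-- The action of the automorphisms of `P` on the cycles. -/
noncomputable def cyclesRep (k : ℕ) : Representation ℚ (P ≃o P) (cycles P k) where
  toFun g := (chainRep P k g).restrict (chainRep_mem_cycles P k g)
  map_one' := LinearMap.ext fun x => Subtype.ext (by
    change chainRep P k 1 x = x
    rw [map_one]; rfl)
  map_mul' g h := LinearMap.ext fun x => Subtype.ext (by
    change chainRep P k (g * h) x = chainRep P k g (chainRep P k h x)
    rw [map_mul]; rfl)

theorem cyclesRep_mem_boundaries (k : ℕ) (g : P ≃o P) :
    boundaries P k ≤ (boundaries P k).comap (cyclesRep P k g) := by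
  rintro x ⟨y, hy⟩
  exact ⟨chainRep P (k + 1) g y, (boundary_chainRep P k g y).trans (congrArg _ hy)⟩

/-- The action of the automorphisms of `P` on the homology of `P`. -/
noncomputable def homologyRep (k : ℕ) : Representation ℚ (P ≃o P) (PosetHomology P k) where
  toFun g := (boundaries P k).mapQ (boundaries P k) (cyclesRep P k g)
    (cyclesRep_mem_boundaries P k g)
  map_one' := Submodule.linearMap_qext _ (LinearMap.ext fun x => by
    change Submodule.Quotient.mk (cyclesRep P k 1 x) = Submodule.Quotient.mk x
    rw [map_one]; rfl)
  map_mul' g h := Submodule.linearMap_qext _ (LinearMap.ext fun x => by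
    change Submodule.Quotient.mk (cyclesRep P k (g * h) x) =
      Submodule.Quotient.mk (cyclesRep P k g (cyclesRep P k h x))
    rw [map_mul]; rfl)

end PosetHomology

section EvenSubsets

/-- The poset `B_n^ev` of subsets of even size of an `n`-element set, ordered by inclusion. -/
abbrev EvenSubset (n : ℕ) : Type := {I : Finset (Fin n) // Even I.card}

/-- The open interval `(∅, [n])` in `B_n^ev` (for even `n`). -/
abbrev EvenInterval (n : ℕ) : Type :=
  {I : EvenSubset n // (∅ : Finset (Fin n)) < I.1 ∧ I.1 < Finset.univ}

/-- The action of a permutation on the even subsets, `w I = {w i | i ∈ I}`. -/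
def evenSubsetMap (n : ℕ) (w : Equiv.Perm (Fin n)) (I : EvenInterval n) : EvenInterval n :=
  ⟨⟨I.1.1.map w.toEmbedding, by rw [Finset.card_map]; exact I.1.2⟩, by
    obtain ⟨h1, h2⟩ := I.2
    have h3 : (Finset.univ : Finset (Fin n)).map w.toEmbedding = Finset.univ :=
      Finset.map_univ_equiv w
    refine ⟨Finset.map_ssubset_map.2 h1, ?_⟩
    exact lt_of_lt_of_eq (Finset.map_ssubset_map.2 h2) h3⟩

theorem evenSubsetMap_mul (n : ℕ) (v w : Equiv.Perm (Fin n)) (I : EvenInterval n) :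
    evenSubsetMap n (v * w) I = evenSubsetMap n v (evenSubsetMap n w I) :=
  Subtype.ext (Subtype.ext (Finset.map_map w.toEmbedding v.toEmbedding I.1.1).symm)

theorem evenSubsetMap_one (n : ℕ) (I : EvenInterval n) : evenSubsetMap n 1 I = I :=
  Subtype.ext (Subtype.ext Finset.map_refl)

/-- The action of `S_n` on the open interval `(∅, [n])` by poset automorphisms. -/
def evenIntervalAction (n : ℕ) : Equiv.Perm (Fin n) →* (EvenInterval n ≃o EvenInterval n) where
  toFun w :=
    { toFun := evenSubsetMap n w
      invFun := evenSubsetMap n w⁻¹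
      left_inv := fun I => by rw [← evenSubsetMap_mul, inv_mul_cancel, evenSubsetMap_one]
      right_inv := fun I => by rw [← evenSubsetMap_mul, mul_inv_cancel, evenSubsetMap_one]
      map_rel_iff' := fun {I J} => Finset.map_subset_map }
  map_one' := RelIso.ext (evenSubsetMap_one n)
  map_mul' v w := RelIso.ext (evenSubsetMap_mul n v w)

/-- The poset homology of the open interval `(∅, [n])` in `B_n^ev` as a representation of `S_n`:
`evenHomology n k` is the reduced homology group `H̃_{k-1}((∅, [n]); ℚ)`. In the degree convention
where `H_m(∅, [n])` stands for `H̃_{m-2}((∅, [n]); ℚ)`, it is `H_{k+1}(∅, [n])`. -/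
noncomputable def evenHomology (n k : ℕ) :
    Representation ℚ (Equiv.Perm (Fin n)) (PosetHomology (EvenInterval n) k) :=
  (homologyRep (EvenInterval n) k).comp (evenIntervalAction n)

end EvenSubsets

end SymRep

namespace SymRep

open Representation

section Matching

variable {P : Type} [PartialOrder P]

theorem exists_insert_chain {k : ℕ} (c : Fin k ↪o P) {e : P} (he : e ∉ Set.range c)
    (hc : IsChain (· ≤ ·) (insert e (Set.range c))) :
    ∃ (c' : Fin (k + 1) ↪o P) (i : Fin (k + 1)),
      c' i = e ∧ (Fin.succAboveOrderEmb i).trans c' = c := by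
  have hcmp (l : Fin k) (hl : ¬ c l < e) : e < c l := by
    have hne : c l ≠ e := fun h => he ⟨l, h⟩
    rcases hc (Set.mem_insert_of_mem _ ⟨l, rfl⟩) (Set.mem_insert _ _) hne with h | h
    · exact absurd (lt_of_le_of_ne h hne) hl
    · exact lt_of_le_of_ne h hne.symm
  obtain ⟨i, hi⟩ : ∃ i : Fin (k + 1), ∀ l : Fin k, l.castSucc < i ↔ c l < e := by
    by_cases h : ∀ l, c l < e
    · exact ⟨Fin.last k, fun l => iff_of_true (Fin.castSucc_lt_last l) (h l)⟩
    · push Not at h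
      obtain ⟨m, hm, hmin⟩ := WellFounded.has_min (wellFounded_lt (α := Fin k))
        {l | ¬ c l < e} h
      refine ⟨m.castSucc, fun l => ⟨fun hl => ?_, fun hl => ?_⟩⟩
      · by_contra h
        exact hmin l h (Fin.castSucc_lt_castSucc_iff.1 hl)
      · rw [Fin.castSucc_lt_castSucc_iff]
        by_contra h
        exact hm ((c.monotone (not_lt.1 h)).trans_lt hl)
  refine ⟨OrderEmbedding.ofStrictMono (i.insertNth e c : Fin (k + 1) → P)
    ((Fin.strictMono_insertNth_iff i e c).2
    ⟨c.strictMono, fun l hl => (hi l).1 hl, fun l hl => hcmp l fun h =>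
      absurd ((hi l).2 h) (not_lt.2 hl)⟩), i, ?_, ?_⟩
  · simp
  · ext l
    simp

theorem insert_chain_unique {k : ℕ} {c c' : Fin (k + 1) ↪o P} {i i' : Fin (k + 1)}
    (h : c i = c' i')
    (h' : (Fin.succAboveOrderEmb i).trans c = (Fin.succAboveOrderEmb i').trans c') :
    c = c' ∧ i = i' := by
  have hr {c c' : Fin (k + 1) ↪o P} {i i' : Fin (k + 1)} (h : c i = c' i')
      (h' : (Fin.succAboveOrderEmb i).trans c = (Fin.succAboveOrderEmb i').trans c') :
      Set.range c ⊆ Set.range c' := by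
    rintro _ ⟨l, rfl⟩
    rcases Fin.eq_self_or_eq_succAbove i l with rfl | ⟨m, rfl⟩
    · exact ⟨i', h.symm⟩
    · exact ⟨i'.succAbove m, (DFunLike.congr_fun h' m).symm⟩
  have hcc : c = c' :=
    OrderEmbedding.range_inj.1 ((hr h h').antisymm (hr h.symm h'.symm))
  subst hcc
  exact ⟨rfl, c.injective h⟩

theorem range_face {k : ℕ} (c : Fin (k + 1) ↪o P) (i : Fin (k + 1)) :
    Set.range ((Fin.succAboveOrderEmb i).trans c) = Set.range c \ {c i} := by
  ext y
  constructor
  · rintro ⟨l, rfl⟩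
    exact ⟨⟨_, rfl⟩, fun h => Fin.succAbove_ne i l (c.injective h)⟩
  · rintro ⟨⟨l, rfl⟩, h⟩
    rcases Fin.eq_self_or_eq_succAbove i l with rfl | ⟨m, rfl⟩
    · exact absurd rfl h
    · exact ⟨m, rfl⟩

theorem isChain_range {k : ℕ} (c : Fin k ↪o P) : IsChain (· ≤ ·) (Set.range c) := by
  rintro _ ⟨a, rfl⟩ _ ⟨b, rfl⟩ _
  rcases le_total a b with h | h
  · exact Or.inl (c.monotone h)
  · exact Or.inr (c.monotone h)

variable {γ : Type}

/-- The homotopy that inserts into a chain the element `e` which a function `e = τ (inv c)` assigns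
to it, with the sign of the position of `e`. -/
noncomputable def insertHomotopy (inv : Set P → γ) (τ : γ → P) (k : ℕ) :
    ChainSpace P k →ₗ[ℚ] ChainSpace P (k + 1) :=
  open Classical in
  Finsupp.linearCombination ℚ fun c : Fin k ↪o P =>
    if h : ∃ p : (Fin (k + 1) ↪o P) × Fin (k + 1),
        p.1 p.2 = τ (inv (Set.range c)) ∧ (Fin.succAboveOrderEmb p.2).trans p.1 = c then
      (-1 : ℚ) ^ (h.choose.2 : ℕ) • Finsupp.single h.choose.1 (1 : ℚ)
    else 0

theorem insertHomotopy_face {inv : Set P → γ} {τ : γ → P} {k : ℕ} (c : Fin (k + 1) ↪o P)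
    (i : Fin (k + 1)) (h : c i = τ (inv (Set.range ((Fin.succAboveOrderEmb i).trans c)))) :
    insertHomotopy inv τ k (Finsupp.single ((Fin.succAboveOrderEmb i).trans c) 1) =
      (-1 : ℚ) ^ (i : ℕ) • Finsupp.single c (1 : ℚ) := by
  have hex : ∃ p : (Fin (k + 1) ↪o P) × Fin (k + 1),
      p.1 p.2 = τ (inv (Set.range ((Fin.succAboveOrderEmb i).trans c))) ∧
      (Fin.succAboveOrderEmb p.2).trans p.1 = (Fin.succAboveOrderEmb i).trans c :=
    ⟨(c, i), h, rfl⟩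
  rw [insertHomotopy, Finsupp.linearCombination_single, one_smul, dif_pos hex]
  obtain ⟨h1, h2⟩ := insert_chain_unique (hex.choose_spec.1.trans h.symm) hex.choose_spec.2
  rw [h1, h2]

theorem insertHomotopy_of_mem {inv : Set P → γ} {τ : γ → P} {k : ℕ} (c : Fin k ↪o P)
    (h : τ (inv (Set.range c)) ∈ Set.range c) :
    insertHomotopy inv τ k (Finsupp.single c 1) = 0 := by
  rw [insertHomotopy, Finsupp.linearCombination_single, one_smul, dif_neg]
  rintro ⟨⟨c', i⟩, h1, h2⟩
  dsimp only at h1 h2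
  rw [← h1, ← h2, range_face] at h
  exact h.2 rfl

/-- The chains on which `inv` has less than `r` elements. -/
noncomputable def lowerChains (inv : Set P → Finset γ) (k r : ℕ) : Submodule ℚ (ChainSpace P k) :=
  Finsupp.supported ℚ ℚ {c | (inv (Set.range c)).card < r}

/-- `e` can be inserted into and deleted from all chains with the invariant `φ`. -/
def IsToggle (inv : Set P → γ) (φ : γ) (e : P) : Prop :=
  ∀ t : Set P, IsChain (· ≤ ·) t → inv t = φ →
    IsChain (· ≤ ·) (insert e t) ∧ inv (insert e t) = φ ∧ inv (t \ {e}) = φ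

theorem insertHomotopy_mem_lowerChains {inv : Set P → Finset γ} {τ : Finset γ → P} {k r : ℕ}
    (c : Fin k ↪o P) (ht : IsToggle inv (inv (Set.range c)) (τ (inv (Set.range c))))
    (hr : (inv (Set.range c)).card < r) :
    insertHomotopy inv τ k (Finsupp.single c 1) ∈ lowerChains inv (k + 1) r := by
  by_cases h : τ (inv (Set.range c)) ∈ Set.range c
  · rw [insertHomotopy_of_mem c h]
    exact zero_mem _
  · obtain ⟨c', i, h1, h2⟩ := exists_insert_chain c h (ht _ (isChain_range c) rfl).1
    subst h2
    rw [insertHomotopy_face c' i h1]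
    refine Submodule.smul_mem _ _ (Finsupp.single_mem_supported ℚ _ ?_)
    obtain ⟨_, h3, -⟩ := ht _ (isChain_range _) rfl
    rw [← h1, range_face, Set.insert_sdiff_singleton, Set.insert_eq_of_mem (Set.mem_range_self i)] at h3
    change (inv (Set.range c')).card < r
    rw [h3, ← range_face]
    exact hr

theorem homotopy_sub_mem_lowerChains {inv : Set P → Finset γ} (hinv : Monotone inv)
    {τ : Finset γ → P} {k : ℕ}
    (hτ : ∀ c : Fin k ↪o P, IsToggle inv (inv (Set.range c)) (τ (inv (Set.range c))))
    (c : Fin (k + 1) ↪o P) (ht : IsToggle inv (inv (Set.range c)) (τ (inv (Set.range c)))) :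
    boundary P (k + 1) (insertHomotopy inv τ (k + 1) (Finsupp.single c 1)) +
      insertHomotopy inv τ k (boundary P k (Finsupp.single c 1)) - Finsupp.single c 1 ∈
        lowerChains inv (k + 1) (inv (Set.range c)).card := by
  have hlow (l : Fin (k + 1)) (hl : inv (Set.range ((Fin.succAboveOrderEmb l).trans c)) ≠
      inv (Set.range c)) : (inv (Set.range ((Fin.succAboveOrderEmb l).trans c))).card <
      (inv (Set.range c)).card := by
    refine Finset.card_lt_card (lt_of_le_of_ne (hinv ?_) hl)
    rw [range_face]
    exact Set.sdiff_subset
  rw [boundary_single, map_sum]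
  by_cases h : τ (inv (Set.range c)) ∈ Set.range c
  · rw [insertHomotopy_of_mem c h, map_zero, zero_add]
    obtain ⟨i, hi⟩ := h
    have hi' : inv (Set.range ((Fin.succAboveOrderEmb i).trans c)) = inv (Set.range c) := by
      rw [range_face, hi]
      exact (ht _ (isChain_range c) rfl).2.2
    rw [← Finset.add_sum_erase _ _ (Finset.mem_univ i), map_smul,
      insertHomotopy_face c i (by rw [hi', hi]), smul_smul, ← mul_pow]
    simp only [mul_neg, mul_one, neg_neg, one_pow, one_smul, add_sub_cancel_left]
    refine Submodule.sum_mem _ fun l hl => ?_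
    rw [map_smul]
    refine Submodule.smul_mem _ _ ?_
    by_cases hl' : inv (Set.range ((Fin.succAboveOrderEmb l).trans c)) = inv (Set.range c)
    · rw [insertHomotopy_of_mem]
      · exact zero_mem _
      · rw [hl', range_face, ← hi]
        exact ⟨⟨i, rfl⟩, fun h => (Finset.ne_of_mem_erase hl) (c.injective h).symm⟩
    · exact insertHomotopy_mem_lowerChains _ (hτ _) (hlow l hl')
  · obtain ⟨c', i, h1, h2⟩ := exists_insert_chain c h (ht _ (isChain_range c) rfl).1
    subst h2
    have hc' : inv (Set.range c') = inv (Set.range ((Fin.succAboveOrderEmb i).trans c')) := by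
      have h3 := (ht _ (isChain_range _) rfl).2.1
      rw [← h1, range_face, Set.insert_sdiff_singleton, Set.insert_eq_of_mem (Set.mem_range_self i)] at h3
      rw [h3, ← range_face]
    rw [insertHomotopy_face c' i h1, map_smul, boundary_single, Fin.sum_univ_succAbove _ i,
      smul_add, smul_smul, ← mul_pow]
    simp only [mul_neg, mul_one, neg_neg, one_pow, one_smul]
    rw [show ∀ u v w : ChainSpace P (k + 1), u + v + w - u = v + w by intros; abel,
      Finset.smul_sum, ← Finset.sum_add_distrib]
    refine Submodule.sum_mem _ fun l _ => ?_
    have hface : (Fin.succAboveOrderEmb (l.predAbove i)).trans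
        ((Fin.succAboveOrderEmb (i.succAbove l)).trans c') =
        (Fin.succAboveOrderEmb l).trans ((Fin.succAboveOrderEmb i).trans c') := by
      ext m
      exact congrArg c' (Fin.succAbove_succAbove_succAbove_predAbove i l m)
    have hval : ((Fin.succAboveOrderEmb (i.succAbove l)).trans c') (l.predAbove i) = c' i :=
      congrArg c' (Fin.succAbove_succAbove_predAbove i l)
    rw [map_smul]
    by_cases hl : inv (Set.range ((Fin.succAboveOrderEmb l).trans
        ((Fin.succAboveOrderEmb i).trans c'))) =
        inv (Set.range ((Fin.succAboveOrderEmb i).trans c'))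
    · have h3 := insertHomotopy_face (inv := inv) (τ := τ)
        ((Fin.succAboveOrderEmb (i.succAbove l)).trans c')
        (l.predAbove i) (by rw [hface, hl, hval, h1])
      rw [hface] at h3
      rw [h3, smul_smul, smul_smul, ← add_smul, ← pow_add, ← pow_add]
      have h4 := Fin.neg_one_pow_succAbove_add_predAbove (R := ℚ) i l
      have h5 : (-1 : ℚ) ^ ((i : ℕ) + (i.succAbove l : ℕ)) +
          (-1) ^ ((l : ℕ) + (l.predAbove i : ℕ)) = 0 := by
        have e1 : ((-1 : ℚ) ^ (i : ℕ)) ^ 2 = 1 := by rw [← pow_mul, mul_comm, pow_mul]; simp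
        have e3 : ((-1 : ℚ) ^ (l.predAbove i : ℕ)) ^ 2 = 1 := by
          rw [← pow_mul, mul_comm, pow_mul]; simp
        simp only [pow_add] at h4 ⊢
        linear_combination ((-1 : ℚ) ^ (i : ℕ) * (-1) ^ (l.predAbove i : ℕ)) * h4 -
          ((-1 : ℚ) ^ (i : ℕ) * (-1) ^ (i.succAbove l : ℕ)) * e3 -
          (-1 : ℚ) ^ (l : ℕ) * (-1) ^ (l.predAbove i : ℕ) * e1
      rw [h5, zero_smul]
      exact zero_mem _
    · have hlt := hlow l hl
      refine Submodule.add_mem _ (Submodule.smul_mem _ _ (Submodule.smul_mem _ _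
        (Finsupp.single_mem_supported ℚ _ ?_)))
        (Submodule.smul_mem _ _ (insertHomotopy_mem_lowerChains _ (hτ _) hlt))
      refine Finset.card_lt_card (lt_of_le_of_ne ?_ fun h3 => hl ?_)
      · rw [← hc']
        refine hinv ?_
        rw [range_face]
        exact Set.sdiff_subset
      · have := (ht _ (isChain_range _) h3).2.2
        rwa [← h1, ← hval, ← range_face, hface] at this

/-- If every chain with at most `k` elements has a toggle, then the order complex is acyclic
in the corresponding degrees. -/
theorem cycles_le_range_boundary {inv : Set P → Finset γ} (hinv : Monotone inv) (k : ℕ)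
    (ht : ∀ j ≤ k, ∀ c : Fin j ↪o P, ∃ e, IsToggle inv (inv (Set.range c)) e) :
    cycles P k ≤ LinearMap.range (boundary P k) := by
  have hne : Nonempty P := by
    obtain ⟨e, -⟩ := ht 0 (Nat.zero_le k)
      (OrderEmbedding.ofStrictMono (fun i : Fin 0 => i.elim0) (fun i => i.elim0))
    exact ⟨e⟩
  let τ (φ : Finset γ) : P := Classical.epsilon fun e => IsToggle inv φ e
  have hτ (j) (hj : j ≤ k) (c : Fin j ↪o P) :
      IsToggle inv (inv (Set.range c)) (τ (inv (Set.range c))) :=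
    Classical.epsilon_spec (ht j hj c)
  cases k with
  | zero =>
    intro x _
    obtain ⟨e⟩ := hne
    let c : Fin 1 ↪o P := OrderEmbedding.ofStrictMono (fun _ => e)
      (fun a b h => absurd h (by rw [Subsingleton.elim a b]; exact lt_irrefl _))
    refine ⟨x ((Fin.succAboveOrderEmb 0).trans c) • Finsupp.single c 1, ?_⟩
    rw [map_smul, boundary_single, Fin.sum_univ_one]
    ext d
    rw [show d = (Fin.succAboveOrderEmb 0).trans c from DFunLike.ext _ _ fun i => i.elim0]
    simp
  | succ k =>
    suffices h : ∀ r, ∀ z ∈ lowerChains inv (k + 1) r, boundary P k z = 0 →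
        z ∈ LinearMap.range (boundary P (k + 1)) by
      intro z hz
      refine h (z.support.sup (fun c : Fin (k + 1) ↪o P => (inv (Set.range c)).card) + 1) z ?_ hz
      exact fun c hc => Nat.lt_succ_of_le
        (Finset.le_sup (f := fun c : Fin (k + 1) ↪o P => (inv (Set.range c)).card) hc)
    intro r
    induction r with
    | zero =>
      intro z hz _
      have : z = 0 := by
        ext c
        by_contra h
        exact Nat.not_lt_zero _ (hz (Finsupp.mem_support_iff.2 h))
      rw [this]
      exact zero_mem _
    | succ r ih =>
      intro z hz hz'
      let D : ChainSpace P (k + 1) →ₗ[ℚ] ChainSpace P (k + 1) :=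
        boundary P (k + 1) ∘ₗ insertHomotopy inv τ (k + 1) +
          insertHomotopy inv τ k ∘ₗ boundary P k - LinearMap.id
      have hD : lowerChains inv (k + 1) (r + 1) ≤ (lowerChains inv (k + 1) r).comap D := by
        rw [lowerChains, Finsupp.supported_eq_span_single, Submodule.span_le]
        rintro _ ⟨c, hc, rfl⟩
        refine Finsupp.supported_mono ?_ (homotopy_sub_mem_lowerChains hinv
          (hτ k (Nat.le_succ k)) c (hτ _ le_rfl c))
        exact fun c' hc' => lt_of_lt_of_le hc' (Nat.le_of_lt_succ hc)
      have hDz : D z = boundary P (k + 1) (insertHomotopy inv τ (k + 1) z) - z := by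
        change boundary P (k + 1) (insertHomotopy inv τ (k + 1) z) +
          insertHomotopy inv τ k (boundary P k z) - z = _
        rw [hz', map_zero, add_zero]
      obtain ⟨y, hy⟩ := ih (D z) (hD hz) (by rw [hDz, map_sub, boundary_boundary, hz', sub_zero])
      refine ⟨insertHomotopy inv τ (k + 1) z - y, ?_⟩
      rw [map_sub, hy, hDz, sub_sub_cancel]

end Matching

section Inversions

variable {n : ℕ}

/-- The inversions of the permutations compatible with a chain of subsets: the pairs `a < b` such
that `b` is contained in a member of the chain that does not contain `a`. -/
noncomputable def inversions (s : Set (EvenInterval n)) : Finset (Fin n × Fin n) :=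
  open Classical in {p | p.1 < p.2 ∧ ∃ y ∈ s, p.2 ∈ y.1.1 ∧ p.1 ∉ y.1.1}

theorem mem_inversions {s : Set (EvenInterval n)} {a b : Fin n} :
    (a, b) ∈ inversions s ↔ a < b ∧ ∃ y ∈ s, b ∈ y.1.1 ∧ a ∉ y.1.1 := by
  simp [inversions]

theorem inversions_mono : Monotone (inversions (n := n)) := by
  rintro s t h ⟨a, b⟩ hp
  obtain ⟨hab, y, hy, h'⟩ := mem_inversions.1 hp
  exact mem_inversions.2 ⟨hab, y, h hy, h'⟩

theorem inversions_union (s t : Set (EvenInterval n)) :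
    inversions (s ∪ t) = inversions s ∪ inversions t := by
  ext ⟨a, b⟩
  simp only [Finset.mem_union, mem_inversions, Set.mem_union]
  constructor
  · rintro ⟨hab, y, hy | hy, h⟩
    · exact Or.inl ⟨hab, y, hy, h⟩
    · exact Or.inr ⟨hab, y, hy, h⟩
  · rintro (⟨hab, y, hy, h⟩ | ⟨hab, y, hy, h⟩)
    · exact ⟨hab, y, Or.inl hy, h⟩
    · exact ⟨hab, y, Or.inr hy, h⟩

theorem subset_or_subset_of_chain {s : Set (EvenInterval n)} (hs : IsChain (· ≤ ·) s)
    {y z : EvenInterval n} (hy : y ∈ s) (hz : z ∈ s) : y.1.1 ⊆ z.1.1 ∨ z.1.1 ⊆ y.1.1 := by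
  rcases eq_or_ne y z with rfl | h
  · exact Or.inl subset_rfl
  · exact hs hy hz h

theorem subset_of_mem_of_notMem {s : Set (EvenInterval n)} (hs : IsChain (· ≤ ·) s)
    {y z : EvenInterval n} (hy : y ∈ s) (hz : z ∈ s) {a : Fin n} (ha : a ∈ z.1.1)
    (ha' : a ∉ y.1.1) : y.1.1 ⊆ z.1.1 :=
  (subset_or_subset_of_chain hs hy hz).resolve_right fun h => ha' (h ha)

theorem isChain_union {s t : Set (EvenInterval n)} (hs : IsChain (· ≤ ·) s)
    (ht : IsChain (· ≤ ·) t) (h : inversions s = inversions t) : IsChain (· ≤ ·) (s ∪ t) := by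
  have key (y) (hy : y ∈ s) (z) (hz : z ∈ t) : y ≤ z ∨ z ≤ y := by
    by_contra! hyz
    obtain ⟨a, ha, ha'⟩ := Finset.not_subset.1 hyz.1
    obtain ⟨b, hb, hb'⟩ := Finset.not_subset.1 hyz.2
    rcases lt_trichotomy a b with hab | rfl | hab
    · obtain ⟨-, w, hw, h1, h2⟩ := mem_inversions.1
        (h.symm ▸ mem_inversions.2 ⟨hab, z, hz, hb, ha'⟩ : (a, b) ∈ inversions s)
      exact hb' (subset_of_mem_of_notMem hs hw hy ha h2 h1)
    · exact ha' hb
    · obtain ⟨-, w, hw, h1, h2⟩ := mem_inversions.1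
        (h ▸ mem_inversions.2 ⟨hab, y, hy, ha, hb'⟩ : (b, a) ∈ inversions t)
      exact ha' (subset_of_mem_of_notMem ht hw hz hb h2 h1)
  rintro y (hy | hy) z (hz | hz) hne
  · exact hs hy hz hne
  · exact key y hy z hz
  · exact (key z hz y hy).symm
  · exact ht hy hz hne

theorem isToggle_of_insert {s : Set (EvenInterval n)} {e : EvenInterval n} (he : e ∉ s)
    (hs : IsChain (· ≤ ·) (insert e s)) (hi : inversions (insert e s) = inversions s) :
    IsToggle inversions (inversions s) e := by
  classical
  intro t ht hts
  have hu : IsChain (· ≤ ·) (t ∪ insert e s) := isChain_union ht hs (hts.trans hi.symm)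
  have hsub : insert e t ⊆ t ∪ insert e s := by
    rintro y (rfl | hy)
    · exact Or.inr (Set.mem_insert _ _)
    · exact Or.inl hy
  refine ⟨hu.mono hsub, ?_, ?_⟩
  · refine ((inversions_mono hsub).trans ?_).antisymm
      (hts.symm.le.trans (inversions_mono (Set.subset_insert _ _)))
    rw [inversions_union, hts, hi, Finset.union_self]
  refine ((inversions_mono Set.sdiff_subset).trans hts.le).antisymm ?_
  rw [← hts]
  rintro ⟨a, b⟩ hab
  by_contra hcon
  obtain ⟨hlt, y, hy, hby, hay⟩ := mem_inversions.1 hab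
  have hsep (z) (hz : z ∈ t) (hze : z ≠ e) (hbz : b ∈ z.1.1) : a ∈ z.1.1 := by
    by_contra haz
    exact hcon (mem_inversions.2 ⟨hlt, z, ⟨hz, hze⟩, hbz, haz⟩)
  obtain rfl : y = e := by
    by_contra hye
    exact hay (hsep y hy hye hby)
  -- the blocks of `a` and `b` in the set partition given by `t`
  let B (x : Fin n) : Finset (Fin n) := {c | ∀ z ∈ t, c ∈ z.1.1 ↔ x ∈ z.1.1}
  have hB {x c : Fin n} : c ∈ B x ↔ ∀ z ∈ t, c ∈ z.1.1 ↔ x ∈ z.1.1 := by simp [B]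
  have hBself (x) : x ∈ B x := hB.2 fun _ _ => Iff.rfl
  obtain ⟨p, hp, hpmax⟩ := (B b).exists_max_image id ⟨b, hBself b⟩
  obtain ⟨q, hq, hqmin⟩ := (B a).exists_min_image id ⟨a, hBself a⟩
  have hqp : q < p := (hqmin a (hBself a)).trans_lt (hlt.trans_le (hpmax b (hBself b)))
  rw [hB] at hp hq
  obtain ⟨-, z, hz, hpz, hqz⟩ := mem_inversions.1 (hts ▸ mem_inversions.2 ⟨hqp, y, hy,
    (hp y hy).2 hby, fun h => hay ((hq y hy).1 h)⟩ : (q, p) ∈ inversions s)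
  have hzu : z ∈ t ∪ insert y s := Or.inr (Set.mem_insert_of_mem _ hz)
  have hyz : y ≠ z := fun h => he (h ▸ hz)
  have hne : y.1.1 ≠ z.1.1 := fun h => hyz (Subtype.ext (Subtype.ext h))
  rcases subset_or_subset_of_chain hu (Or.inl hy) hzu with h | h
  · obtain ⟨d, hdz, hdy⟩ := Finset.exists_of_ssubset (h.ssubset_of_ne hne)
    have hd : d ∈ B a := hB.2 fun w hw => by
      rcases eq_or_ne w y with rfl | hwy
      · exact iff_of_false hdy hay
      refine ⟨fun hdw => ?_, fun haw =>
        subset_of_mem_of_notMem hu hzu (Or.inl hw) ((hq w hw).2 haw) hqz hdz⟩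
      by_contra haw
      exact hdy (subset_of_mem_of_notMem ht hw hy hby (fun hbw => haw (hsep w hw hwy hbw)) hdw)
    have hqd : q < d := lt_of_le_of_ne (hqmin d hd) (by rintro rfl; exact hqz hdz)
    obtain ⟨-, w, hw, hdw, hqw⟩ := mem_inversions.1
      (hts.symm ▸ mem_inversions.2 ⟨hqd, z, hz, hdz, hqz⟩ : (q, d) ∈ inversions t)
    exact hqw ((hq w hw).2 ((hB.1 hd w hw).1 hdw))
  · obtain ⟨c, hcy, hcz⟩ := Finset.exists_of_ssubset (h.ssubset_of_ne hne.symm)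
    have hc : c ∈ B b := hB.2 fun w hw => by
      rcases eq_or_ne w y with rfl | hwy
      · exact iff_of_true hcy hby
      refine ⟨fun hcw => ?_, fun hbw =>
        subset_of_mem_of_notMem ht hy hw (hsep w hw hwy hbw) hay hcy⟩
      by_contra hbw
      exact hcz (subset_of_mem_of_notMem hu (Or.inl hw) hzu hpz (fun h => hbw ((hp w hw).1 h)) hcw)
    have hcp : c < p := lt_of_le_of_ne (hpmax c hc) (by rintro rfl; exact hcz hpz)
    obtain ⟨-, w, hw, hpw, hcw⟩ := mem_inversions.1
      (hts.symm ▸ mem_inversions.2 ⟨hcp, z, hz, hpz, hcz⟩ : (c, p) ∈ inversions t)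
    exact hcw ((hB.1 hc w hw).2 ((hp w hw).1 hpw))

theorem exists_insert_inversions_eq {j : ℕ} (hj : j < n / 2 - 1) (c : Fin j ↪o EvenInterval n) :
    ∃ e ∉ Set.range c, IsChain (· ≤ ·) (insert e (Set.range c)) ∧
      inversions (insert e (Set.range c)) = inversions (Set.range c) := by
  classical
  obtain ⟨i, hi⟩ : ∃ i : Fin (n / 2 - 1), ∀ l, (c l).1.1.card ≠ 2 * i + 2 := by
    by_contra! h
    choose f hf using h
    have hinj : Function.Injective f := fun i i' hii => by
      have h1 := hf i
      rw [hii, hf i'] at h1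
      exact Fin.ext (by omega)
    have := Fintype.card_le_of_injective f hinj
    simp at this
    omega
  let level (a : Fin n) : ℕ := (Finset.univ.filter fun l => a ∉ (c l).1.1).card
  let key (a : Fin n) : ℕ ×ₗ Fin n := toLex (level a, a)
  let σ := Tuple.sort key
  let E : Finset (Fin n) := (Finset.univ.filter fun x : Fin n => (x : ℕ) < 2 * i + 2).map
    σ.toEmbedding
  have hin := i.2
  have hEcard : E.card = 2 * i + 2 := by
    rw [Finset.card_map, Fin.card_filter_val_lt]
    omega
  have hE {a b : Fin n} (hb : b ∈ E) (ha : a ∉ E) : key b ≤ key a := by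
    obtain ⟨x, rfl⟩ := σ.surjective b
    obtain ⟨x', rfl⟩ := σ.surjective a
    simp only [E, Finset.mem_map_equiv, Equiv.symm_apply_apply, Finset.mem_filter,
      Finset.mem_univ, true_and] at ha hb
    exact Tuple.monotone_sort key (Fin.le_def.2 (by omega))
  let e : EvenInterval n := ⟨⟨E, by rw [hEcard]; exact ⟨i + 1, by ring⟩⟩, by
    constructor
    · refine Finset.empty_ssubset.2 (Finset.card_pos.1 ?_)
      change 0 < E.card
      omega
    · refine Finset.ssubset_univ_iff.2 fun h => ?_
      have h' : E = Finset.univ := h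
      rw [h', Finset.card_univ, Fintype.card_fin] at hEcard
      omega⟩
  have hchain := isChain_range c
  have hcmp (l) : (c l).1.1 ⊆ E ∨ E ⊆ (c l).1.1 := by
    by_contra! h
    obtain ⟨a, ha, haE⟩ := Finset.not_subset.1 h.1
    obtain ⟨b, hbE, hb⟩ := Finset.not_subset.1 h.2
    have hlt : level a < level b := by
      refine Finset.card_lt_card (Finset.ssubset_iff_of_subset ?_ |>.2 ⟨l, by simpa, by simpa⟩)
      intro l' hl'
      simp only [Finset.mem_filter, Finset.mem_univ, true_and] at hl' ⊢
      exact fun h => hb (subset_of_mem_of_notMem hchain ⟨l', rfl⟩ ⟨l, rfl⟩ ha hl' h)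
    exact absurd (hE hbE haE) (not_le.2 (Prod.Lex.toLex_lt_toLex.2 (Or.inl hlt)))
  refine ⟨e, ?_, ?_, ?_⟩
  · rintro ⟨l, hl⟩
    exact hi l ((congrArg (fun y : EvenInterval n => y.1.1.card) hl).trans hEcard)
  · refine hchain.insert ?_
    rintro _ ⟨l, rfl⟩ _
    exact (hcmp l).symm
  · refine Finset.Subset.antisymm ?_ (inversions_mono (Set.subset_insert _ _))
    rintro ⟨a, b⟩ hab
    obtain ⟨hlt, y, rfl | hy, hby, hay⟩ := mem_inversions.1 hab
    · have hlevel : level b < level a := by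
        rcases Prod.Lex.toLex_le_toLex.1 (hE hby hay) with h | ⟨-, h⟩
        · exact h
        · exact absurd h (not_le.2 hlt)
      obtain ⟨l, hl, hl'⟩ := Finset.exists_mem_notMem_of_card_lt_card hlevel
      simp only [Finset.mem_filter, Finset.mem_univ, true_and, not_not] at hl hl'
      exact mem_inversions.2 ⟨hlt, c l, ⟨l, rfl⟩, hl', hl⟩
    · exact mem_inversions.2 ⟨hlt, y, hy, hby, hay⟩

/-- The open interval `(∅, [n])` in the poset of even subsets is acyclic below its dimension. -/
theorem cycles_evenInterval {k : ℕ} (hk : k < n / 2 - 1) :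
    cycles (EvenInterval n) k ≤ LinearMap.range (boundary (EvenInterval n) k) := by
  refine cycles_le_range_boundary inversions_mono k fun j hj c => ?_
  obtain ⟨e, h1, h2, h3⟩ := exists_insert_inversions_eq (hj.trans_lt hk) c
  exact ⟨e, isToggle_of_insert h1 h2 h3⟩

theorem isEmpty_chain {k : ℕ} (hn : 2 ≤ n) (hn' : Even n) (hk : n / 2 ≤ k) :
    IsEmpty (Fin k ↪o EvenInterval n) := by
  refine ⟨fun c => ?_⟩
  have hc (l : Fin k) : (c l).1.1.card / 2 ∈ Finset.Ico 1 (n / 2) := by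
    obtain ⟨h0, h1⟩ := (c l).2
    obtain ⟨a, ha⟩ := (c l).1.2
    obtain ⟨b, rfl⟩ := hn'
    have h0 := Finset.card_lt_card h0
    have h1 := Finset.card_lt_card h1
    rw [Finset.card_empty] at h0
    rw [Finset.card_univ, Fintype.card_fin] at h1
    rw [Finset.mem_Ico]
    omega
  have hinj : Function.Injective fun l => (c l).1.1.card / 2 := by
    refine StrictMono.injective fun l l' hl => ?_
    have h := Finset.card_lt_card (c.strictMono hl)
    obtain ⟨a, ha⟩ := (c l).1.2
    obtain ⟨b, hb⟩ := (c l').1.2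
    omega
  have := Finset.card_le_card_of_injOn (s := Finset.univ) _ (fun l _ => hc l) hinj.injOn
  rw [Finset.card_univ, Fintype.card_fin, Nat.card_Ico] at this
  omega

end Inversions

section PermRep

variable {G H : Type} [Group G] [Group H]

/-- The permutation representation on the vector space with basis a `G`-set `X`. -/
noncomputable def permRep (G X : Type) [Group G] [MulAction G X] :
    Representation ℚ G (X →₀ ℚ) where
  toFun g := Finsupp.lmapDomain ℚ ℚ fun x => g • x
  map_one' := by
    ext x : 1
    refine LinearMap.ext_ring ?_
    change Finsupp.mapDomain _ (Finsupp.single x 1) = Finsupp.single x 1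
    rw [Finsupp.mapDomain_single, one_smul]
  map_mul' g h := by
    ext x : 1
    refine LinearMap.ext_ring ?_
    change Finsupp.mapDomain _ (Finsupp.single _ _) =
      Finsupp.mapDomain _ (Finsupp.mapDomain _ (Finsupp.single _ _))
    rw [Finsupp.mapDomain_single, Finsupp.mapDomain_single, Finsupp.mapDomain_single, mul_smul]

variable {X Y Z : Type} [MulAction G X] [MulAction G Y] [MulAction G Z]

theorem permRep_single (g : G) (x : X) (a : ℚ) :
    permRep G X g (Finsupp.single x a) = Finsupp.single (g • x) a :=
  Finsupp.mapDomain_single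

/-- The intertwining map from a permutation representation given by an equivariant map. -/
noncomputable def permLift {W : Type} [AddCommGroup W] [Module ℚ W] {τ : Representation ℚ G W}
    (F : X → W) (hF : ∀ g x, F (g • x) = τ g (F x)) : IntertwiningMap (permRep G X) τ :=
  ⟨Finsupp.linearCombination ℚ F, fun g => by
    ext x : 1
    refine LinearMap.ext_ring ?_
    change Finsupp.linearCombination ℚ F (permRep G X g (Finsupp.single x 1)) =
      τ g (Finsupp.linearCombination ℚ F (Finsupp.single x 1))
    rw [permRep_single, Finsupp.linearCombination_single, Finsupp.linearCombination_single,
      one_smul, one_smul, hF]⟩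

theorem permLift_single {W : Type} [AddCommGroup W] [Module ℚ W] {τ : Representation ℚ G W}
    (F : X → W) (hF : ∀ g x, F (g • x) = τ g (F x)) (x : X) :
    permLift F hF (Finsupp.single x 1) = F x := by
  change Finsupp.linearCombination ℚ F (Finsupp.single x 1) = F x
  rw [Finsupp.linearCombination_single, one_smul]

theorem permRep_hom_ext {W : Type} [AddCommGroup W] [Module ℚ W] {τ : Representation ℚ G W}
    {f g : IntertwiningMap (permRep G X) τ}
    (h : ∀ x, f (Finsupp.single x 1) = g (Finsupp.single x 1)) : f = g := by
  ext : 1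
  ext x : 1
  exact LinearMap.ext_ring (h x)

theorem of_permRep_sum [Finite X] [Finite Y] [Finite Z] (e : X ⊕ Y ≃ Z)
    (hX : ∀ (g : G) x, e (Sum.inl (g • x)) = g • e (Sum.inl x))
    (hY : ∀ (g : G) y, e (Sum.inr (g • y)) = g • e (Sum.inr y)) :
    RepGroup.of (permRep G Z) = RepGroup.of (permRep G X) + RepGroup.of (permRep G Y) := by
  have hX' (g : G) (x) : e.symm (g • e (Sum.inl x)) = Sum.inl (g • x) := by
    rw [← hX, e.symm_apply_apply]
  have hY' (g : G) (x) : e.symm (g • e (Sum.inr x)) = Sum.inr (g • x) := by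
    rw [← hY, e.symm_apply_apply]
  let f : IntertwiningMap (permRep G X) (permRep G Z) :=
    permLift (fun x => Finsupp.single (e (Sum.inl x)) 1) fun g x => by rw [permRep_single, hX]
  let s : IntertwiningMap (permRep G Y) (permRep G Z) :=
    permLift (fun x => Finsupp.single (e (Sum.inr x)) 1) fun g x => by rw [permRep_single, hY]
  let r : IntertwiningMap (permRep G Z) (permRep G X) :=
    permLift (fun z => Sum.elim (fun x => Finsupp.single x 1) 0 (e.symm z)) fun g z => by
      obtain ⟨x | y, rfl⟩ := e.surjective z
      · rw [hX', e.symm_apply_apply, Sum.elim_inl, Sum.elim_inl, permRep_single]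
      · rw [hY', e.symm_apply_apply, Sum.elim_inr, Sum.elim_inr, Pi.zero_apply, Pi.zero_apply,
          map_zero]
  let p : IntertwiningMap (permRep G Z) (permRep G Y) :=
    permLift (fun z => Sum.elim 0 (fun x => Finsupp.single x 1) (e.symm z)) fun g z => by
      obtain ⟨x | y, rfl⟩ := e.surjective z
      · rw [hX', e.symm_apply_apply, Sum.elim_inl, Sum.elim_inl, Pi.zero_apply, Pi.zero_apply,
          map_zero]
      · rw [hY', e.symm_apply_apply, Sum.elim_inr, Sum.elim_inr, permRep_single]
  have hf (x) : f (Finsupp.single x 1) = Finsupp.single (e (Sum.inl x)) 1 := permLift_single ..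
  have hs (y) : s (Finsupp.single y 1) = Finsupp.single (e (Sum.inr y)) 1 := permLift_single ..
  have hr1 (x) : r (Finsupp.single (e (Sum.inl x)) 1) = Finsupp.single x 1 :=
    (permLift_single ..).trans (by rw [e.symm_apply_apply, Sum.elim_inl])
  have hr2 (y) : r (Finsupp.single (e (Sum.inr y)) 1) = 0 :=
    (permLift_single ..).trans (by rw [e.symm_apply_apply, Sum.elim_inr, Pi.zero_apply])
  have hp1 (x) : p (Finsupp.single (e (Sum.inl x)) 1) = 0 :=
    (permLift_single ..).trans (by rw [e.symm_apply_apply, Sum.elim_inl, Pi.zero_apply])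
  have hp2 (y) : p (Finsupp.single (e (Sum.inr y)) 1) = Finsupp.single y 1 :=
    (permLift_single ..).trans (by rw [e.symm_apply_apply, Sum.elim_inr])
  refine RepGroup.of_split f p r s (permRep_hom_ext fun x => ?_) (permRep_hom_ext fun y => ?_)
    (permRep_hom_ext fun x => ?_) (permRep_hom_ext fun z => ?_)
  · change r (f _) = Finsupp.single x 1
    rw [hf, hr1]
  · change p (s _) = Finsupp.single y 1
    rw [hs, hp2]
  · change p (f _) = 0
    rw [hf, hp1]
  · change f (r _) + s (p _) = Finsupp.single z 1
    obtain ⟨x | y, rfl⟩ := e.surjective z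
    · rw [hr1, hp1, hf, map_zero, add_zero]
    · rw [hr2, hp2, hs, map_zero, zero_add]

theorem of_permRep_congr [Finite X] [Finite Y] (e : X ≃ Y)
    (he : ∀ (g : G) x, e (g • x) = g • e x) :
    RepGroup.of (permRep G X) = RepGroup.of (permRep G Y) := by
  have he' (g : G) (y) : e.symm (g • y) = g • e.symm y := by
    rw [e.symm_apply_eq, he, e.apply_symm_apply]
  refine RepGroup.of_congr
    (permLift (fun x => Finsupp.single (e x) 1) fun g x => by rw [permRep_single, he])
    (permLift (fun y => Finsupp.single (e.symm y) 1) fun g x => by rw [permRep_single, he'])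
    (permRep_hom_ext fun x => ?_) (permRep_hom_ext fun y => ?_)
  · rw [IntertwiningMap.comp_apply, permLift_single, permLift_single, e.symm_apply_apply]; rfl
  · rw [IntertwiningMap.comp_apply, permLift_single, permLift_single, e.apply_symm_apply]; rfl

theorem of_permRep_of_isEmpty [IsEmpty X] : RepGroup.of (permRep G X) = 0 :=
  left_eq_add.1 (of_permRep_sum (G := G) (X := X) (Y := X) (Z := X) (Equiv.equivOfIsEmpty _ _)
    (fun _ x => isEmptyElim x) fun _ x => isEmptyElim x)

variable {ι : Type}

/-- The points of a `G`-set at which an invariant function has a value in `T`. -/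
def levelSet (f : X → ι) (hf : ∀ (g : G) x, f (g • x) = f x) (T : Set ι) : SubMulAction G X where
  carrier := {x | f x ∈ T}
  smul_mem' g x hx := by
    change f (g • x) ∈ T
    rwa [hf]

theorem of_permRep_eq_sum_levelSet [Finite X] (f : X → ι) (hf : ∀ (g : G) x, f (g • x) = f x)
    (T : Finset ι) (hT : ∀ x, f x ∈ T) :
    RepGroup.of (permRep G X) = ∑ i ∈ T, RepGroup.of (permRep G (levelSet f hf {i})) := by
  classical
  have key (T : Finset ι) : RepGroup.of (permRep G (levelSet f hf T)) =
      ∑ i ∈ T, RepGroup.of (permRep G (levelSet f hf {i})) := by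
    induction T using Finset.induction_on with
    | empty =>
      have : IsEmpty (levelSet f hf ((∅ : Finset ι) : Set ι)) :=
        ⟨fun x => Finset.notMem_empty _ x.2⟩
      rw [Finset.sum_empty, of_permRep_of_isEmpty]
    | insert i T hi ih =>
      rw [Finset.sum_insert hi, ← ih]
      refine of_permRep_sum (Equiv.ofBijective (Sum.elim
        (fun x : levelSet f hf {i} => ⟨x.1, Finset.mem_coe.2 (Finset.mem_insert.2 (Or.inl x.2))⟩)
        (fun x : levelSet f hf T => ⟨x.1, Finset.mem_coe.2 (Finset.mem_insert_of_mem x.2)⟩)) ⟨?_, ?_⟩)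
        (fun _ _ => rfl) (fun _ _ => rfl)
      · rintro (⟨x, hx⟩ | ⟨x, hx⟩) (⟨y, hy⟩ | ⟨y, hy⟩) h
        · obtain rfl : x = y := congrArg Subtype.val h
          rfl
        · obtain rfl : x = y := congrArg Subtype.val h
          have hx : f x = i := hx
          exact absurd (hx ▸ hy) hi
        · obtain rfl : x = y := congrArg Subtype.val h
          have hy : f x = i := hy
          exact absurd (hy ▸ hx) hi
        · obtain rfl : x = y := congrArg Subtype.val h
          rfl
      · rintro ⟨x, hx⟩
        rcases Finset.mem_insert.1 (Finset.mem_coe.1 hx) with h | h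
        · exact ⟨Sum.inl ⟨x, h⟩, rfl⟩
        · exact ⟨Sum.inr ⟨x, h⟩, rfl⟩
  rw [← key]
  exact of_permRep_congr ⟨fun x => ⟨x, hT x⟩, fun x => x.1, fun _ => rfl, fun _ => rfl⟩
    fun _ _ => rfl

/-- If `X` is the `G`-set induced from an `H`-set `B`, then the permutation representation on `X`
is induced from the one on `B`. -/
theorem of_ind_eq_of_permRep [Finite G] [Finite X] {B : Type} [Finite B] (φ : H →* G)
    (ρ : Representation ℚ H (B →₀ ℚ)) (act : H → B → B)
    (hρ : ∀ h b, ρ h (Finsupp.single b 1) = Finsupp.single (act h b) 1)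
    (j : B → X) (hj : ∀ h b, j (act h b) = φ h • j b) (hsurj : ∀ x, ∃ (g : G) (b : B), g • j b = x)
    (hinj : ∀ (g : G) b b', g • j b = j b' → ∃ h, φ h = g ∧ act h b = b') :
    RepGroup.of (ρ.ind φ) = RepGroup.of (permRep G X) := by
  have hwd (g g' : G) (b b' : B) (h : g • j b = g' • j b') :
      ρ.ind φ g (indMk φ ρ (Finsupp.single b 1)) =
        ρ.ind φ g' (indMk φ ρ (Finsupp.single b' 1)) := by
    obtain ⟨h, hg, rfl⟩ := hinj (g'⁻¹ * g) b b' (by rw [mul_smul, h, inv_smul_smul])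
    rw [← hρ, ind_mk_equivariant, rho_rho, hg, mul_inv_cancel_left]
  choose γ β hγ using hsurj
  let F : IntertwiningMap (ρ.ind φ) (permRep G X) :=
    indLift (Finsupp.lmapDomain ℚ ℚ j) (fun h v => by
      refine LinearMap.congr_fun (f := Finsupp.lmapDomain ℚ ℚ j ∘ₗ ρ h)
        (g := permRep G X (φ h) ∘ₗ Finsupp.lmapDomain ℚ ℚ j) ?_ v
      ext b : 1
      refine LinearMap.ext_ring ?_
      change Finsupp.mapDomain j (ρ h (Finsupp.single b 1)) =
        permRep G X (φ h) (Finsupp.mapDomain j (Finsupp.single b 1))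
      rw [hρ, Finsupp.mapDomain_single, Finsupp.mapDomain_single, permRep_single, hj])
  have hF (b) : F (indMk φ ρ (Finsupp.single b 1)) = Finsupp.single (j b) 1 :=
    (indLift_mk ..).trans Finsupp.mapDomain_single
  let E : IntertwiningMap (permRep G X) (ρ.ind φ) :=
    permLift (fun x => ρ.ind φ (γ x) (indMk φ ρ (Finsupp.single (β x) 1))) fun g x => by
      rw [rho_rho]
      exact hwd _ _ _ _ (by rw [hγ, mul_smul, hγ])
  have hE (x) : E (Finsupp.single x 1) = ρ.ind φ (γ x) (indMk φ ρ (Finsupp.single (β x) 1)) :=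
    permLift_single ..
  refine RepGroup.of_congr F E (ind_ext fun v => ?_) (permRep_hom_ext fun x => ?_)
  · refine LinearMap.congr_fun (f := E.toLinearMap ∘ₗ F.toLinearMap ∘ₗ indMk φ ρ)
      (g := indMk φ ρ) ?_ v
    ext b : 1
    refine LinearMap.ext_ring ?_
    change E (F (indMk φ ρ (Finsupp.single b 1))) = indMk φ ρ (Finsupp.single b 1)
    rw [hF, hE, ← rho_one (ρ.ind φ) (indMk φ ρ (Finsupp.single b 1))]
    exact hwd _ _ _ _ (by rw [hγ, one_smul])
  · change F (E (Finsupp.single x 1)) = Finsupp.single x 1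
    rw [hE, F.isIntertwining, hF, permRep_single, hγ]

theorem of_extTensor_trivial {V : Type} [AddCommGroup V] [Module ℚ V] [Module.Finite ℚ V]
    (ρ : Representation ℚ G V) :
    RepGroup.of (extTensor ρ (Representation.trivial ℚ H ℚ)) =
      RepGroup.of (MonoidHom.comp ρ (MonoidHom.fst G H)) := by
  let e := TensorProduct.rid ℚ V
  have he (p : G × H) (v) : e (extTensor ρ (Representation.trivial ℚ H ℚ) p v) = ρ p.1 (e v) := by
    refine LinearMap.congr_fun (f := e.toLinearMap ∘ₗ
      extTensor ρ (Representation.trivial ℚ H ℚ) p) (g := ρ p.1 ∘ₗ e.toLinearMap)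
      (TensorProduct.ext' fun a b => ?_) v
    change b • ρ p.1 a = ρ p.1 (b • a)
    rw [map_smul]
  refine RepGroup.of_congr (LinearMap.intertwiningMap_of_isIntertwiningMap _ _ e.toLinearMap he)
    (LinearMap.intertwiningMap_of_isIntertwiningMap _ _ e.symm.toLinearMap fun p v => ?_) ?_ ?_
  · change e.symm (ρ p.1 v) = _
    rw [LinearEquiv.symm_apply_eq]
    exact ((he p _).trans (by rw [LinearEquiv.coe_coe, e.apply_symm_apply])).symm
  · exact IntertwiningMap.ext (LinearMap.ext e.symm_apply_apply)
  · exact IntertwiningMap.ext (LinearMap.ext e.apply_symm_apply)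

end PermRep

section EvenChains

/-- The `k`-element chains in the open interval `(∅, [n])` of the poset of even subsets. -/
abbrev EvenChain (n k : ℕ) : Type := Fin k ↪o EvenInterval n

instance (n k : ℕ) : Finite (EvenChain n k) := DFunLike.finite _

instance (n k : ℕ) : MulAction (Equiv.Perm (Fin n)) (EvenChain n k) where
  smul g c := c.trans (evenIntervalAction n g).toOrderEmbedding
  one_smul c := DFunLike.ext _ _ fun l => evenSubsetMap_one n (c l)
  mul_smul g h c := DFunLike.ext _ _ fun l => evenSubsetMap_mul n g h (c l)

theorem EvenChain.smul_apply {n k : ℕ} (g : Equiv.Perm (Fin n)) (c : EvenChain n k) (l : Fin k) :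
    (g • c) l = evenSubsetMap n g (c l) := rfl

variable {i j n k : ℕ}

/-- The first `i` of `n = i + j` elements. -/
def initialSet (h : i + j = n) : Finset (Fin n) :=
  Finset.univ.map (Function.Embedding.inl.trans (finSumFinEquiv.trans (finCongr h)).toEmbedding)

theorem mem_initialSet {h : i + j = n} {a : Fin n} :
    a ∈ initialSet h ↔ ∃ x : Fin i, finSumFinEquiv.trans (finCongr h) (Sum.inl x) = a := by
  simp [initialSet]

theorem card_initialSet (h : i + j = n) : (initialSet h).card = i := by
  simp [initialSet]

/-- The set of the first `i` of `n = i + j` elements as an element of the poset of even subsets. -/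
def initialElement (h : i + j = n) (hi : 2 ≤ i) (hi' : Even i) (hj : 2 ≤ j) : EvenInterval n :=
  ⟨⟨initialSet h, by rwa [card_initialSet]⟩, by
    refine ⟨Finset.empty_ssubset.2 (Finset.card_pos.1 ?_), Finset.ssubset_univ_iff.2 fun e => ?_⟩
    · change 0 < (initialSet h).card
      rw [card_initialSet]
      omega
    · have e' : initialSet h = Finset.univ := e
      have := card_initialSet h
      rw [e', Finset.card_univ, Fintype.card_fin] at this
      omega⟩

/-- An even subset of the first `i` of `n = i + j` elements, as an element of the poset of even
subsets of `[n]`. -/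
def extendElement (h : i + j = n) (I : EvenInterval i) : EvenInterval n :=
  ⟨⟨I.1.1.map (Function.Embedding.inl.trans (finSumFinEquiv.trans (finCongr h)).toEmbedding), by
    rw [Finset.card_map]
    exact I.1.2⟩, by
    obtain ⟨h1, h2⟩ := I.2
    refine ⟨Finset.empty_ssubset.2 (Finset.map_nonempty.2 (Finset.empty_ssubset.1 h1)), ?_⟩
    exact lt_of_lt_of_le (Finset.map_ssubset_map.2 h2) (Finset.subset_univ _)⟩

theorem extendElement_lt_extendElement (h : i + j = n) {I J : EvenInterval i} :
    extendElement h I < extendElement h J ↔ I < J :=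
  Finset.map_ssubset_map

theorem extendElement_injective (h : i + j = n) : Function.Injective (extendElement h) :=
  fun _ _ hIJ => Subtype.ext (Subtype.ext (Finset.map_injective _
    (congrArg (fun K : EvenInterval n => K.1.1) hIJ)))

theorem extendElement_lt_initialElement (h : i + j = n) (hi : 2 ≤ i) (hi' : Even i) (hj : 2 ≤ j)
    (I : EvenInterval i) : extendElement h I < initialElement h hi hi' hj :=
  Finset.map_ssubset_map.2 I.2.2

theorem exists_extendElement_eq {h : i + j = n} {hi : 2 ≤ i} {hi' : Even i} {hj : 2 ≤ j}
    {J : EvenInterval n} (hJ : J < initialElement h hi hi' hj) : ∃ I, extendElement h I = J := by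
  obtain ⟨I, -, hI⟩ := Finset.subset_map_iff.1 (show J.1.1 ⊆ initialSet h from hJ.le)
  have hcard : J.1.1.card = I.card := by rw [hI, Finset.card_map]
  refine ⟨⟨⟨I, hcard ▸ J.1.2⟩, ?_, ?_⟩, Subtype.ext (Subtype.ext hI.symm)⟩
  · have := Finset.card_lt_card J.2.1
    refine Finset.empty_ssubset.2 (Finset.card_pos.1 ?_)
    rw [← hcard]
    simpa using this
  · refine Finset.ssubset_univ_iff.2 fun e => ?_
    have := Finset.card_lt_card (show J.1.1 ⊂ initialSet h from hJ)
    rw [hcard, card_initialSet] at this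
    have e' : I = Finset.univ := e
    rw [e', Finset.card_univ, Fintype.card_fin] at this
    exact lt_irrefl _ this

theorem extendElement_smul (h : i + j = n) (p : Equiv.Perm (Fin i) × Equiv.Perm (Fin j))
    (I : EvenInterval i) : extendElement h (evenSubsetMap i p.1 I) =
      evenSubsetMap n (youngHom h p) (extendElement h I) := by
  refine Subtype.ext (Subtype.ext ?_)
  change (Finset.map _ I.1.1).map _ = (Finset.map _ I.1.1).map _
  rw [Finset.map_map, Finset.map_map]
  congr 1
  ext a
  exact congrArg Fin.val (sumPermHom_inl (finSumFinEquiv.trans (finCongr h)) p a).symm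

theorem smul_initialElement (h : i + j = n) (hi : 2 ≤ i) (hi' : Even i) (hj : 2 ≤ j)
    (p : Equiv.Perm (Fin i) × Equiv.Perm (Fin j)) :
    evenSubsetMap n (youngHom h p) (initialElement h hi hi' hj) = initialElement h hi hi' hj := by
  refine Subtype.ext (Subtype.ext (Finset.eq_of_subset_of_card_le (fun a ha => ?_) ?_))
  · obtain ⟨b, hb, rfl⟩ := Finset.mem_map.1 ha
    obtain ⟨x, rfl⟩ := mem_initialSet.1 hb
    exact mem_initialSet.2 ⟨p.1 x, (sumPermHom_inl _ p x).symm⟩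
  · exact (Finset.card_map _).ge

theorem exists_youngHom_eq (h : i + j = n) (g : Equiv.Perm (Fin n))
    (hg : (initialSet h).map g.toEmbedding = initialSet h) : ∃ p, youngHom h p = g := by
  let e := finSumFinEquiv.trans (finCongr h)
  obtain ⟨p, hp⟩ := Equiv.Perm.mem_sumCongrHom_range_of_perm_mapsTo_inl
    (σ := e.symm.permCongr g) (by
    rintro _ ⟨x, rfl⟩
    obtain ⟨y, hy⟩ := mem_initialSet.1 (hg ▸ Finset.mem_map_of_mem g.toEmbedding
      (mem_initialSet.2 ⟨x, rfl⟩) : g (e (Sum.inl x)) ∈ initialSet h)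
    refine ⟨y, ?_⟩
    rw [Equiv.permCongr_apply, Equiv.symm_symm, ← Equiv.apply_eq_iff_eq e, e.apply_symm_apply]
    exact hy)
  refine ⟨p, ?_⟩
  change e.permCongr (Equiv.Perm.sumCongrHom _ _ p) = g
  rw [hp]
  ext x
  simp

theorem exists_perm_map_eq {A B : Finset (Fin n)} (h : A.card = B.card) :
    ∃ g : Equiv.Perm (Fin n), A.map g.toEmbedding = B := by
  let e : {x // x ∈ A} ≃ {x // x ∈ B} := Fintype.equivOfCardEq (by simpa using h)
  refine ⟨e.extendSubtype, Finset.eq_of_subset_of_card_le (fun b hb => ?_) ?_⟩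
  · obtain ⟨a, ha, rfl⟩ := Finset.mem_map.1 hb
    exact e.extendSubtype_mem a ha
  · rw [Finset.card_map, h]

/-- The extension of a chain of even subsets of the first `i` of `n` elements by the set of these
`i` elements. -/
def extendChain (h : i + j = n) (hi : 2 ≤ i) (hi' : Even i) (hj : 2 ≤ j) (c : EvenChain i k) :
    EvenChain n (k + 1) :=
  OrderEmbedding.ofStrictMono (Fin.snoc (α := fun _ => EvenInterval n)
    (fun l => extendElement h (c l)) (initialElement h hi hi' hj)) (by
      rw [← Fin.insertNth_last', Fin.strictMono_insertNth_iff]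
      exact ⟨fun a b hab => (extendElement_lt_extendElement h).2 (c.strictMono hab),
        fun l _ => extendElement_lt_initialElement h hi hi' hj (c l),
        fun l hl => absurd hl (not_le.2 (Fin.castSucc_lt_last l))⟩)

section

variable (h : i + j = n) (hi : 2 ≤ i) (hi' : Even i) (hj : 2 ≤ j)

theorem extendChain_castSucc (c : EvenChain i k) (l : Fin k) :
    extendChain h hi hi' hj c l.castSucc = extendElement h (c l) :=
  Fin.snoc_castSucc (α := fun _ => EvenInterval n) _ (fun l => extendElement h (c l)) l

theorem extendChain_last (c : EvenChain i k) :
    extendChain h hi hi' hj c (Fin.last k) = initialElement h hi hi' hj :=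
  Fin.snoc_last (α := fun _ => EvenInterval n) _ (fun l => extendElement h (c l))

theorem extendChain_injective : Function.Injective (extendChain (k := k) h hi hi' hj) := by
  intro c c' hc
  refine DFunLike.ext _ _ fun l => extendElement_injective h ?_
  rw [← extendChain_castSucc h hi hi' hj, hc, extendChain_castSucc]

theorem extendChain_smul (p : Equiv.Perm (Fin i) × Equiv.Perm (Fin j)) (c : EvenChain i k) :
    extendChain h hi hi' hj (p.1 • c) = youngHom h p • extendChain h hi hi' hj c := by
  refine DFunLike.ext _ _ fun l => ?_
  rw [EvenChain.smul_apply]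
  induction l using Fin.lastCases with
  | last => rw [extendChain_last, extendChain_last, smul_initialElement]
  | cast l =>
    rw [extendChain_castSucc, extendChain_castSucc, EvenChain.smul_apply, extendElement_smul]

theorem exists_extendChain_eq (c : EvenChain n (k + 1))
    (hc : c (Fin.last k) = initialElement h hi hi' hj) :
    ∃ c', extendChain h hi hi' hj c' = c := by
  have hl (l : Fin k) : ∃ I, extendElement h I = c l.castSucc :=
    exists_extendElement_eq (hc ▸ c.strictMono (Fin.castSucc_lt_last l))
  choose I hI using hl
  refine ⟨OrderEmbedding.ofStrictMono I fun a b hab => ?_, DFunLike.ext _ _ fun l => ?_⟩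
  · rw [← extendElement_lt_extendElement h, hI, hI]
    exact c.strictMono (Fin.castSucc_lt_castSucc_iff.2 hab)
  · induction l using Fin.lastCases with
    | last => rw [extendChain_last, hc]
    | cast l =>
      rw [extendChain_castSucc, ← hI]
      rfl

end

/-- The sizes of the last set of a nonempty chain and of its complement. -/
def lastType (n k : ℕ) (c : EvenChain n (k + 1)) : ℕ × ℕ :=
  ((c (Fin.last k)).1.1.card, n - (c (Fin.last k)).1.1.card)

theorem lastType_smul (g : Equiv.Perm (Fin n)) (c : EvenChain n (k + 1)) :
    lastType n k (g • c) = lastType n k c := by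
  have : ((g • c) (Fin.last k)).1.1.card = (c (Fin.last k)).1.1.card := Finset.card_map _
  rw [lastType, this, lastType]

/-- The class of the representation on the `k`-element chains in the open interval `(∅, [n])`. -/
noncomputable def chainClass (n k : ℕ) : RepGroup (Equiv.Perm (Fin n)) :=
  RepGroup.of (permRep (Equiv.Perm (Fin n)) (EvenChain n k))

theorem of_permRep_levelSet_lastType (h : i + j = n) (hi : 2 ≤ i) (hi' : Even i) (hj : 2 ≤ j) :
    RepGroup.of (permRep (Equiv.Perm (Fin n)) (levelSet (lastType n k) lastType_smul {(i, j)})) =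
      indProd h (chainClass i k) (trivialClass j) := by
  rw [indProd_apply, chainClass, trivialClass, RepGroup.tensor_of, of_extTensor_trivial,
    RepGroup.ind_of]
  symm
  have hlast (c : EvenChain i k) :
      extendChain h hi hi' hj c ∈ levelSet (lastType n k) lastType_smul {(i, j)} := by
    change lastType n k _ = (i, j)
    have : (extendChain h hi hi' hj c (Fin.last k)).1.1.card = i := by
      rw [extendChain_last]
      exact card_initialSet h
    rw [lastType, this, Prod.mk.injEq]
    omega
  refine of_ind_eq_of_permRep (youngHom h) _ (fun p c => p.1 • c)
    (fun p c => permRep_single p.1 c 1) (fun c => ⟨extendChain h hi hi' hj c, hlast c⟩)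
    (fun p c => Subtype.ext (extendChain_smul h hi hi' hj p c)) ?_ ?_
  · rintro ⟨c, hc⟩
    have hc' : lastType n k c = (i, j) := hc
    obtain ⟨g, hg⟩ := exists_perm_map_eq
      ((card_initialSet h).trans (congrArg Prod.fst hc').symm)
    obtain ⟨c', hc'⟩ := exists_extendChain_eq h hi hi' hj (g⁻¹ • c) (by
      rw [EvenChain.smul_apply]
      have : c (Fin.last k) = evenSubsetMap n g (initialElement h hi hi' hj) :=
        Subtype.ext (Subtype.ext hg.symm)
      rw [this, ← evenSubsetMap_mul, inv_mul_cancel, evenSubsetMap_one])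
    refine ⟨g, c', Subtype.ext ?_⟩
    change g • extendChain h hi hi' hj c' = c
    rw [hc', smul_inv_smul]
  · intro g c c' hcc
    have hcc' : g • extendChain h hi hi' hj c = extendChain h hi hi' hj c' :=
      congrArg Subtype.val hcc
    have hl := DFunLike.congr_fun hcc' (Fin.last k)
    rw [EvenChain.smul_apply, extendChain_last, extendChain_last] at hl
    obtain ⟨p, rfl⟩ := exists_youngHom_eq h g (congrArg (fun J : EvenInterval n => J.1.1) hl)
    refine ⟨p, rfl, extendChain_injective h hi hi' hj ?_⟩
    rw [extendChain_smul, hcc']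

theorem chainClass_succ (hn : Even n) : chainClass n (k + 1) =
    ∑ p ∈ (Finset.HasAntidiagonal.antidiagonal n).filter (fun p => (2 ≤ p.1 ∧ Even p.1) ∧ 2 ≤ p.2 ∧ Even p.2),
      if h : p.1 + p.2 = n then indProd h (chainClass p.1 k) (trivialClass p.2) else 0 := by
  rw [chainClass, of_permRep_eq_sum_levelSet (lastType n k) lastType_smul]
  · refine Finset.sum_congr rfl fun p hp => ?_
    obtain ⟨hp, ⟨h1, h2⟩, h3, h4⟩ := Finset.mem_filter.1 hp
    have h := Finset.HasAntidiagonal.mem_antidiagonal.1 hp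
    rw [dif_pos h]
    exact of_permRep_levelSet_lastType h h1 h2 h3
  · intro c
    obtain ⟨h1, h2⟩ := (c (Fin.last k)).2
    obtain ⟨a, ha⟩ := (c (Fin.last k)).1.2
    obtain ⟨b, rfl⟩ := hn
    have h1 := Finset.card_lt_card h1
    have h2 := Finset.card_lt_card h2
    rw [Finset.card_empty] at h1
    rw [Finset.card_univ, Fintype.card_fin] at h2
    simp only [lastType, Finset.mem_filter, Finset.HasAntidiagonal.mem_antidiagonal, Nat.even_iff]
    omega

theorem chainClass_zero (n : ℕ) : chainClass n 0 = trivialClass n := by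
  have c₀ : EvenChain n 0 := OrderEmbedding.ofStrictMono (fun i : Fin 0 => i.elim0) fun i => i.elim0
  have hc (c : EvenChain n 0) : c₀ = c := DFunLike.ext _ _ fun i => i.elim0
  let F : IntertwiningMap (permRep (Equiv.Perm (Fin n)) (EvenChain n 0))
      (Representation.trivial ℚ (Equiv.Perm (Fin n)) ℚ) :=
    permLift (fun _ => (1 : ℚ)) fun _ _ => rfl
  have hF (c) : F (Finsupp.single c 1) = (1 : ℚ) := permLift_single ..
  refine RepGroup.of_congr F (LinearMap.intertwiningMap_of_isIntertwiningMap _ _ (Finsupp.lsingle c₀) fun g a => ?_)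
    (permRep_hom_ext fun c => ?_) (IntertwiningMap.ext (LinearMap.ext_ring ?_))
  · change Finsupp.single c₀ a = permRep _ _ g (Finsupp.single c₀ a)
    rw [permRep_single, ← hc (g • c₀)]
  · change Finsupp.single c₀ (F (Finsupp.single c 1)) = Finsupp.single c 1
    rw [hF, hc c]
  · exact hF c₀

end EvenChains

section CyclesClass

variable {P : Type} [PartialOrder P] {G : Type} [Group G] (α : G →* (P ≃o P))

theorem boundary_mem_cycles (k : ℕ) (x : ChainSpace P (k + 1)) : boundary P k x ∈ cycles P k := by
  cases k with
  | zero => trivial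
  | succ k => exact boundary_boundary P k x

variable [Finite P]

/-- The class of the representation on the cycles of the order complex. -/
noncomputable def cyclesClass (k : ℕ) : RepGroup G :=
  RepGroup.of (MonoidHom.comp (cyclesRep P k) α)

theorem of_chainRep_succ {k : ℕ} (hk : cycles P k ≤ LinearMap.range (boundary P k)) :
    RepGroup.of (MonoidHom.comp (chainRep P (k + 1)) α) =
      cyclesClass α (k + 1) + cyclesClass α k := by
  refine RepGroup.of_exact
    (LinearMap.intertwiningMap_of_isIntertwiningMap _ _ (cycles P (k + 1)).subtype
      fun _ _ => rfl)
    (LinearMap.intertwiningMap_of_isIntertwiningMap _ _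
      ((boundary P k).codRestrict (cycles P k) (boundary_mem_cycles k))
      fun g x => Subtype.ext (boundary_chainRep P k (α g) x))
    Subtype.val_injective ?_ ?_
  · rintro ⟨z, hz⟩
    obtain ⟨x, hx⟩ := hk hz
    exact ⟨x, Subtype.ext hx⟩
  · intro x
    constructor
    · intro hx
      exact ⟨⟨x, congrArg Subtype.val hx⟩, rfl⟩
    · rintro ⟨⟨y, hy⟩, rfl⟩
      exact Subtype.ext hy

theorem of_chainRep_zero :
    RepGroup.of (MonoidHom.comp (chainRep P 0) α) = cyclesClass α 0 :=
  RepGroup.of_congr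
    (LinearMap.intertwiningMap_of_isIntertwiningMap _ _
      (LinearMap.codRestrict (cycles P 0) LinearMap.id fun _ => trivial) fun _ _ => rfl)
    (LinearMap.intertwiningMap_of_isIntertwiningMap _ _ (cycles P 0).subtype fun _ _ => rfl)
    rfl rfl

theorem of_homologyRep_of_isEmpty {k : ℕ} [IsEmpty (Fin (k + 1) ↪o P)] :
    RepGroup.of (MonoidHom.comp (homologyRep P k) α) = cyclesClass α k := by
  have hb : boundaries P k = ⊥ := by
    rw [boundaries, Subsingleton.elim (boundary P k) 0, LinearMap.range_zero]
    exact (cycles P k).ker_subtype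
  let e := Submodule.quotEquivOfEqBot _ hb
  have he (x) : e (Submodule.Quotient.mk x) = x := Submodule.quotEquivOfEqBot_apply_mk _ hb x
  refine RepGroup.of_congr (LinearMap.intertwiningMap_of_isIntertwiningMap _ _ e.toLinearMap ?_)
    (LinearMap.intertwiningMap_of_isIntertwiningMap _ _ (boundaries P k).mkQ fun _ _ => rfl)
    (IntertwiningMap.ext (LinearMap.ext fun x => ?_)) (IntertwiningMap.ext (LinearMap.ext he))
  · intro g x
    obtain ⟨x, rfl⟩ := Submodule.Quotient.mk_surjective _ x
    exact (he _).trans (congrArg (cyclesRep P k (α g)) (he x).symm)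
  · obtain ⟨x, rfl⟩ := Submodule.Quotient.mk_surjective _ x
    exact congrArg Submodule.Quotient.mk (he x)

end CyclesClass

section EvenHomology

variable {n : ℕ}

theorem chainClass_eq (n k : ℕ) : RepGroup.of (MonoidHom.comp (chainRep (EvenInterval n) k)
    (evenIntervalAction n)) = chainClass n k := rfl

theorem cyclesClass_eq_sum (m : ℕ) (hm : m ≤ n / 2 - 1) :
    (-1 : ℤ) ^ (m + 1) • cyclesClass (evenIntervalAction n) m =
      ∑ k ∈ Finset.range (m + 1), (-1 : ℤ) ^ (k + 1) • chainClass n k := by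
  induction m with
  | zero => rw [Finset.sum_range_one, ← chainClass_eq, of_chainRep_zero]
  | succ m ih =>
    rw [Finset.sum_range_succ, ← ih (by omega), ← chainClass_eq,
      of_chainRep_succ _ (cycles_evenInterval hm), smul_add, pow_succ _ (m + 1)]
    simp

theorem chainClass_eq_zero (hn : 2 ≤ n) (hn' : Even n) {k : ℕ} (hk : n / 2 ≤ k) :
    chainClass n k = 0 := by
  have : IsEmpty (EvenChain n k) := isEmpty_chain hn hn' hk
  exact of_permRep_of_isEmpty

/-- The top homology of the open interval `(∅, [n])` in terms of its chains. -/
theorem evenHomology_eq_sum (hn : 2 ≤ n) (hn' : Even n) {N : ℕ} (hN : n / 2 ≤ N) :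
    (-1 : ℤ) ^ (n / 2) • RepGroup.of (evenHomology n (n / 2 - 1)) =
      ∑ k ∈ Finset.range N, (-1 : ℤ) ^ (k + 1) • chainClass n k := by
  have hsucc : n / 2 - 1 + 1 = n / 2 := by omega
  have : IsEmpty (Fin (n / 2 - 1 + 1) ↪o EvenInterval n) :=
    isEmpty_chain hn hn' hsucc.ge
  have h := cyclesClass_eq_sum (n := n) _ le_rfl
  rw [hsucc] at h
  rw [evenHomology, of_homologyRep_of_isEmpty, h]
  refine Finset.sum_subset (Finset.range_mono hN) fun k _ hk => ?_
  rw [chainClass_eq_zero hn hn' (by simpa using hk), smul_zero]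

end EvenHomology

namespace CompletedRing

/-- The component of degree `n`. -/
noncomputable def coeff (n : ℕ) : CompletedRing →+ RepGroup (Equiv.Perm (Fin n)) :=
  AddMonoidHom.mk' (fun a => a n) fun _ _ => rfl

theorem coeff_apply (n : ℕ) (a : CompletedRing) : coeff n a = a n := rfl

theorem mul_coeff_congr {a b c : CompletedRing} {n : ℕ} (h : ∀ m ≤ n, b m = c m) :
    (a * b) n = (a * c) n := by
  rw [mul_coeff, mul_coeff]
  refine Finset.sum_congr rfl fun p _ => ?_
  rw [h _ (by have := Finset.HasAntidiagonal.mem_antidiagonal.1 p.2; omega)]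

/-- The sum of the classes `1_{S_n}` over all positive even `n`. -/
noncomputable def evenTrivial : CompletedRing :=
  formalSum fun n => if 2 ≤ n ∧ Even n then trivialClass n else 0

theorem evenTrivial_pow_succ (k n : ℕ) :
    (evenTrivial ^ (k + 1)) n = if 2 ≤ n ∧ Even n then chainClass n k else 0 := by
  induction k generalizing n with
  | zero =>
    rw [zero_add, pow_one, chainClass_zero]
    rfl
  | succ k ih =>
    have hterm (p : ℕ × ℕ) : (if h : p.1 + p.2 = n then
          indProd h ((evenTrivial ^ (k + 1)) p.1) (evenTrivial p.2) else 0) =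
        if (2 ≤ p.1 ∧ Even p.1) ∧ 2 ≤ p.2 ∧ Even p.2 then
          if h : p.1 + p.2 = n then indProd h (chainClass p.1 k) (trivialClass p.2) else 0
        else 0 := by
      have h2 : evenTrivial p.2 = if 2 ≤ p.2 ∧ Even p.2 then trivialClass p.2 else 0 := rfl
      rw [ih, h2]
      by_cases hp1 : 2 ≤ p.1 ∧ Even p.1 <;> by_cases hp2 : 2 ≤ p.2 ∧ Even p.2 <;>
        simp [hp1, hp2]
    rw [pow_succ, mul_coeff', Finset.sum_congr rfl fun p _ => hterm p, ← Finset.sum_filter]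
    split_ifs with hn
    · rw [chainClass_succ hn.2]
    · refine Finset.sum_eq_zero fun p hp => ?_
      obtain ⟨-, ⟨h1, h2⟩, h3, h4⟩ := Finset.mem_filter.1 hp
      rw [dif_neg]
      rintro rfl
      exact hn ⟨by omega, h2.add h4⟩

theorem neg_evenTrivial_pow (k n : ℕ) :
    ((-evenTrivial) ^ (k + 1)) n =
      if 2 ≤ n ∧ Even n then (-1 : ℤ) ^ (k + 1) • chainClass n k else 0 := by
  have : (-evenTrivial) ^ (k + 1) = ((-1 : ℤ) ^ (k + 1)) • evenTrivial ^ (k + 1) := by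
    rw [neg_pow, zsmul_eq_mul]
    push_cast
    rfl
  rw [this, ← coeff_apply n (_ • _), map_zsmul, coeff_apply, evenTrivial_pow_succ]
  split_ifs
  · rfl
  · rw [smul_zero]

/-- The sum of the classes `(-1)^{n/2} H_{n/2}(∅, [n])` over all positive even `n`. -/
noncomputable def evenHomologySum : CompletedRing :=
  formalSum fun n => if 2 ≤ n ∧ Even n then
    (-1 : ℤ) ^ (n / 2) • RepGroup.of (evenHomology n (n / 2 - 1)) else 0

theorem evenHomologySum_coeff {m n : ℕ} (hm : m ≤ n) :
    (1 + evenHomologySum) m = (∑ k ∈ Finset.range (n + 1), (-evenTrivial) ^ k) m := by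
  rw [Finset.sum_range_succ', pow_zero, add_comm, add_coeff, add_coeff, ← coeff_apply m (∑ k ∈ _, _),
    map_sum]
  simp only [coeff_apply, neg_evenTrivial_pow]
  congr 1
  change (if _ then _ else _) = _
  split_ifs with h
  · exact evenHomology_eq_sum h.1 h.2 (by omega)
  · rw [Finset.sum_const_zero]

theorem one_add_evenTrivial_mul : (1 + evenTrivial) * (1 + evenHomologySum) = 1 := by
  refine ext fun n => ?_
  rw [mul_coeff_congr fun m hm => evenHomologySum_coeff hm]
  have h := mul_neg_geom_sum (-evenTrivial) (n + 1)
  rw [sub_neg_eq_add] at h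
  rw [h, ← coeff_apply n (_ - _), map_sub, coeff_apply, coeff_apply, neg_evenTrivial_pow]
  split_ifs with hn
  · rw [chainClass_eq_zero hn.1 hn.2 (by omega), smul_zero, sub_zero]
  · rw [sub_zero]

end CompletedRing

end SymRep

theorem proposition3p1 :
    IsUnit (1 + SymRep.CompletedRing.formalSum fun n =>
      if 2 ≤ n ∧ Even n then SymRep.trivialClass n else 0) ∧
    1 + SymRep.CompletedRing.formalSum (fun n =>
        if 2 ≤ n ∧ Even n then
          (-1 : ℤ) ^ (n / 2) • SymRep.RepGroup.of (SymRep.evenHomology n (n / 2 - 1))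
        else 0) =
      Ring.inverse (1 + SymRep.CompletedRing.formalSum fun n =>
        if 2 ≤ n ∧ Even n then SymRep.trivialClass n else 0) := by
  have h := SymRep.CompletedRing.one_add_evenTrivial_mul
  have hu : IsUnit (1 + SymRep.CompletedRing.evenTrivial) := IsUnit.of_mul_eq_one _ h
  refine ⟨hu, ?_⟩
  change 1 + SymRep.CompletedRing.evenHomologySum =
    Ring.inverse (1 + SymRep.CompletedRing.evenTrivial)
  calc
    _ = Ring.inverse (1 + SymRep.CompletedRing.evenTrivial) *
        (1 + SymRep.CompletedRing.evenTrivial) * (1 + SymRep.CompletedRing.evenHomologySum) := by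
      rw [Ring.inverse_mul_cancel _ hu, one_mul]
    _ = _ := by rw [mul_assoc, h, mul_one]
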